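/- **Setting.** Let $\{\xi(t)\}_{t\in\mathbb R}$ and $\{\eta(t)\}_{t\in\mathbb R}$ be complex-valued, zero-mean, mutually uncorrelated wide-sense stationary processes on a probability space with spectral densities $f,g$, i.e. $f,g\ge 0$ are integrable on $\mathbb R$ and $E\,\xi(t)\overline{\xi(u)}=\frac1{2\pi}\int_{\mathbb R}e^{i(t-u)\lambda}f(\lambda)\,d\lambda$, $E\,\eta(t)\overline{\eta(u)}=\frac1{2\pi}\int_{\mathbb R}e^{i(t-u)\lambda}g(\lambda)\,d\lambda$, $E\,\xi(t)\overline{\eta(u)}=0$. Let $Z_\xi,Z_\eta$ be their orthogonal stochastic measures, so that $\xi(t)=\int e^{it\lambda}Z_\xi(d\lambda)$ and $\eta(t)=\int e^{it\lambda}Z_\eta(d\lambda)$. Assume the minimality condition: there is a nontrivial function of exponential type $\gamma(\lambda)=\int_0^\infty\alpha(t)e^{it\lambda}dt$, with $\alpha$ integrable on $[0,\infty)$, such that $\int_{\mathbb R}\frac{|\gamma(\lambda)|^2}{f(\lambda)+g(\lambda)}d\lambda<\infty$. Let $s\ge 0$ be an integer, $N_k,K_k\ge 0$, $N_0=K_0=0$,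 $M_l=\sum_{k=0}^l(N_k+K_k)$, and put $S=\bigcup_{l=1}^s[-M_l-N_l,-M_l]$, $S^+=\bigcup_{l=1}^s[M_l,M_l+N_l]$, $R^s=[0,\infty)\setminus S^+$, $T=S\cup[0,\infty)$, $\mathbb R^-=(-\infty,0)$. Let $a:R^s\to\mathbb C$ satisfy $\int_{R^s}|a(t)|\,dt<\infty$, $\int_{R^s}|a(t)|^2dt<\infty$, $\int_{R^s}t|a(t)|^2dt<\infty$. Put $A(e^{i\lambda})=\int_{R^s}a(t)e^{-it\lambda}dt$, $A\xi=\int_{R^s}a(t)\xi(-t)\,dt$ (a mean-square integral), and let $\mathbf a\in L_2(T)$ be equal to $a$ on $R^s$ and to $0$ on $T\setminus R^s$. The optimal linear estimate $\hat A\xi$ is the orthogonal projection of $A\xi$ onto the closed span $H^s(\xi+\eta)$ of $\{\xi(t)+\eta(t):t\in\mathbb R^-\setminus S\}$ in $L_2(P)$. Its spectral characteristic is the function $h\in L_2^s(f+g)$ with $\hat A\xi=\int h(e^{i\lambda})(Z_\xi(d\lambda)+Z_\eta(d\lambda))$, where $L_2^s(f+g)$ is the closed span of $\{e^{it\lambda}:t\in\mathbb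 R^-\setminus S\}$ in $L_2((f+g)\,d\lambda)$. Its mean-square error is $\Delta=E|A\xi-\hat A\xi|^2$. Let $\langle x,y\rangle=\int_T x(t)\overline{y(t)}\,dt$. For $x\in L_2(T)$ let $\hat x(\lambda)=\int_T x(u)e^{iu\lambda}du$ (Fourier–Plancherel transform), and consider the following operators in $L_2(T)$. * $(\mathbf Bx)(t)=\frac1{2\pi}\int_T x(u)\int_{\mathbb R}\frac{e^{i\lambda(u-t)}}{f(\lambda)+g(\lambda)}\,d\lambda\,du$. Since $1/(f+g)$ is not integrable, this is understood as the (unbounded) operator in $L_2(T)$ of the quadratic form $\frac1{2\pi}\int_{\mathbb R}\frac{|\hat x|^2}{f+g}d\lambda$: $\mathbf Bx=r$ means that $r\in L_2(T)$, that $\int\frac{|\hat x|^2}{f+g}d\lambda<\infty$, and that $\frac1{2\pi}\int\frac{\hat x\,\overline{\hat y}}{f+g}d\lambda=\langle r,y\rangle$ for all $y\in L_2(T)$ with $\int\frac{|\hat y|^2}{f+g}d\lambda<\infty$. * $(\mathbf Rx)(t)=\frac1{2\pi}\int_T x(u)\int_{\mathbb R}e^{-i\lambda(u+t)}\frac{f(\lambda)}{f(\lambda)+g(\lambda)}\,d\lambda\,du$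 (integrated first over $u$, in the sense of Plancherel). * $(\mathbf Qx)(t)=\frac1{2\pi}\int_T x(u)\int_{\mathbb R}e^{-i\lambda(u-t)}\frac{f(\lambda)g(\lambda)}{f(\lambda)+g(\lambda)}\,d\lambda\,du$. **Theorem.** Assume that $\mathbf B$ is invertible, i.e. is single-valued and maps its domain bijectively onto $L_2(T)$. Put $C(e^{i\lambda})=\int_T(\mathbf B^{-1}\mathbf R\mathbf a)(t)\,e^{it\lambda}dt$ (Fourier–Plancherel transform). Then the spectral characteristic of the optimal linear estimate of $A\xi$ from the observations $\xi(t)+\eta(t)$, $t\in\mathbb R^-\setminus S$, is $$h(e^{i\lambda})=A(e^{i\lambda})\frac{f(\lambda)}{f(\lambda)+g(\lambda)}-\frac{C(e^{i\lambda})}{f(\lambda)+g(\lambda)},$$ and its mean-square error is $$\Delta=\frac1{2\pi}\int_{\mathbb R}\frac{|A(e^{i\lambda})g(\lambda)+C(e^{i\lambda})|^2}{(f(\lambda)+g(\lambda))^2}f(\lambda)\,d\lambda+\frac1{2\pi}\int_{\mathbb R}\frac{|A(e^{i\lambda})f(\lambda)-C(e^{i\lambda})|^2}{(f(\lambda)+g(\lambda))^2}g(\lambda)\,d\lambda=\langle\mathbf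 R\mathbf a,\mathbf B^{-1}\mathbf R\mathbf a\rangle+\langle\mathbf Q\mathbf a,\mathbf a\rangle,$$ both integrals being finite. -/

import Mathlib

open MeasureTheory Complex
open scoped FourierTransform ComplexConjugate ENNReal

noncomputable section

namespace Filtering

/-! ### Square-integrable functions -/

/-- The class in `L₂(μ)` of a square-integrable function `u`
(and `0` when `u` is not square-integrable). -/
def classL2 {X : Type*} [MeasurableSpace X] (μ : Measure X) (u : X → ℂ) : Lp ℂ 2 μ :=
  open Classical in if h : MemLp u 2 μ then h.toLp u else 0

/-- The exponential `λ ↦ e^{itλ}`. -/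
def expFun (t : ℝ) : ℝ → ℂ := fun l => exp (I * t * l)

/-! ### Second-order stationary processes and their spectral representation -/

/-- `ξ` is a zero-mean (wide-sense) stationary process with absolutely continuous spectral
measure of density `f / 2π`. -/
structure IsStationary {Ω : Type*} [MeasurableSpace Ω] (P : Measure Ω)
    (ξ : ℝ → Ω → ℂ) (f : ℝ → ℝ) : Prop where
  memLp : ∀ t, MemLp (ξ t) 2 P
  mean_zero : ∀ t, ∫ ω, ξ t ω ∂P = 0
  density_nonneg : ∀ l, 0 ≤ f l
  density_integrable : Integrable f
  covariance : ∀ t u, ∫ ω, ξ t ω * conj (ξ u ω) ∂P =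
    (1 / (2 * Real.pi) : ℂ) * ∫ l, expFun (t - u) l * (f l : ℂ)

/-- The two processes are uncorrelated. -/
def Uncorrelated {Ω : Type*} [MeasurableSpace Ω] (P : Measure Ω) (ξ η : ℝ → Ω → ℂ) : Prop :=
  ∀ t u, ∫ ω, ξ t ω * conj (η u ω) ∂P = 0

/-- The spectral measure `F(dλ) = (1/2π) f(λ) dλ`. -/
def specMeasure (f : ℝ → ℝ) : Measure ℝ :=
  volume.withDensity fun l => ENNReal.ofReal (f l / (2 * Real.pi))

/-- The stochastic integral `h ↦ ∫ h(λ) Z_ξ(dλ)` with respect to the orthogonal stochastic measure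
`Z_ξ` of the stationary process `ξ` with spectral density `f`: the continuous linear map
`L₂(F) → L₂(P)` that extends `∑ c_k e^{i t_k λ} ↦ ∑ c_k ξ(t_k)` from the (dense) space of
trigonometric sums. -/
def spectralMap {Ω : Type*} [MeasurableSpace Ω] (P : Measure Ω) (ξ : ℝ → Ω → ℂ) (f : ℝ → ℝ) :
    Lp ℂ 2 (specMeasure f) →L[ℂ] Lp ℂ 2 P :=
  (Finsupp.linearCombination ℂ fun t : ℝ => classL2 P (ξ t)).extendOfNorm
    (Finsupp.linearCombination ℂ fun t : ℝ => classL2 (specMeasure f) (expFun t))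

/-- The stochastic integral `∫ h(λ) Z_ξ(dλ)`. -/
def spectralIntegral {Ω : Type*} [MeasurableSpace Ω] (P : Measure Ω) (ξ : ℝ → Ω → ℂ) (f : ℝ → ℝ)
    (h : ℝ → ℂ) : Lp ℂ 2 P :=
  spectralMap P ξ f (classL2 (specMeasure f) h)

/-- The minimality condition: `∫ |γ(λ)|² / (f(λ) + g(λ)) dλ < ∞` for some nontrivial function
`γ(λ) = ∫_0^∞ α(t) e^{itλ} dt` of exponential type. -/
def Minimality (f g : ℝ → ℝ) : Prop :=
  ∃ (α : ℝ → ℂ) (γ : ℂ → ℂ), IntegrableOn α (Set.Ici 0) ∧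
    Differentiable ℂ γ ∧ (∃ C σ : ℝ, ∀ z, ‖γ z‖ ≤ C * Real.exp (σ * ‖z‖)) ∧
    (∀ l : ℝ, γ l = ∫ t in Set.Ici 0, α t * expFun t l) ∧
    (∃ l : ℝ, γ l ≠ 0) ∧
    ∫⁻ l : ℝ, ‖γ l‖ₑ ^ 2 / ENNReal.ofReal (f l + g l) < ∞

/-! ### The observation pattern -/

/-- The numbers `N_0, N_1, …` and `K_0, K_1, …` that describe the `s` gaps in the observations. -/
structure Gaps where
  s : ℕ
  N : ℕ → ℝ
  K : ℕ → ℝ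
  N_zero : N 0 = 0
  K_zero : K 0 = 0
  N_nonneg : ∀ k, 0 ≤ N k
  K_nonneg : ∀ k, 0 ≤ K k

namespace Gaps

variable (G : Gaps)

/-- `M_l = ∑_{k=0}^l (N_k + K_k)`. -/
def M (l : ℕ) : ℝ := ∑ k ∈ Finset.range (l + 1), (G.N k + G.K k)

/-- `S = ⋃_{l=1}^s [-M_l - N_l, -M_l]`. -/
def S : Set ℝ := ⋃ l ∈ Finset.Icc 1 G.s, Set.Icc (-G.M l - G.N l) (-G.M l)

/-- `S⁺ = ⋃_{l=1}^s [M_l, M_l + N_l]`. -/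
def Splus : Set ℝ := ⋃ l ∈ Finset.Icc 1 G.s, Set.Icc (G.M l) (G.M l + G.N l)

/-- `R^s = [0, ∞) \ S⁺`. -/
def R : Set ℝ := Set.Ici 0 \ G.Splus

/-- `T = S ∪ [0, ∞)`. -/
def T : Set ℝ := G.S ∪ Set.Ici 0

/-- The times of observation `ℝ⁻ \ S`. -/
def obs : Set ℝ := Set.Iio 0 \ G.S

theorem measurableSet_S : MeasurableSet G.S :=
  Finset.measurableSet_biUnion _ fun _ _ => measurableSet_Icc

theorem measurableSet_Splus : MeasurableSet G.Splus :=
  Finset.measurableSet_biUnion _ fun _ _ => measurableSet_Icc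

theorem measurableSet_R : MeasurableSet G.R := measurableSet_Ici.diff G.measurableSet_Splus

theorem measurableSet_T : MeasurableSet G.T := G.measurableSet_S.union measurableSet_Ici

/-- The Hilbert space `L₂(T)`. -/
abbrev L2T : Type := Lp ℂ 2 (volume.restrict G.T)

/-- Extension by zero `L₂(T) → L₂(ℝ)`. -/
def extend (x : G.L2T) : Lp ℂ 2 (volume : Measure ℝ) :=
  ((memLp_indicator_iff_restrict G.measurableSet_T).2 (Lp.memLp x)).toLp (G.T.indicator x)

theorem extend_add (x y : G.L2T) : G.extend (x + y) = G.extend x + G.extend y := by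
  unfold extend
  rw [← MemLp.toLp_add]
  refine MemLp.toLp_congr _ _ ?_
  have h := (ae_restrict_iff' G.measurableSet_T).1 (Lp.coeFn_add x y)
  filter_upwards [h] with t ht
  by_cases hT : t ∈ G.T
  · simpa [Set.indicator, hT] using ht hT
  · simp [Set.indicator, hT]

theorem extend_smul (c : ℂ) (x : G.L2T) : G.extend (c • x) = c • G.extend x := by
  unfold extend
  rw [← MemLp.toLp_const_smul]
  refine MemLp.toLp_congr _ _ ?_
  have h := (ae_restrict_iff' G.measurableSet_T).1 (Lp.coeFn_smul c x)
  filter_upwards [h] with t ht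
  by_cases hT : t ∈ G.T
  · simpa [Set.indicator, hT] using ht hT
  · simp [Set.indicator, hT]

/-! ### Fourier transforms

Mathlib's transform on `L₂(ℝ)` extends `(𝓕 x)(w) = ∫ x(u) e^{-2πiuw} du`, and `𝓕⁻` is its
inverse. -/

/-- `λ ↦ ∫_T x(u) e^{iuλ} du`, in the sense of Plancherel. -/
def fourierPlus (x : G.L2T) : ℝ → ℂ := fun l => (𝓕⁻ (G.extend x)) (l / (2 * Real.pi))

/-- `λ ↦ ∫_T x(u) e^{-iuλ} du`, in the sense of Plancherel. -/
def fourierMinus (x : G.L2T) : ℝ → ℂ := fun l => (𝓕 (G.extend x)) (l / (2 * Real.pi))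

/-- `t ↦ (1/2π) ∫ e^{-iλt} φ(λ) dλ` for `t ∈ T`, in the sense of Plancherel
(substitute `λ = 2πw`). -/
def synth (φ : ℝ → ℂ) : G.L2T :=
  LpToLpRestrictCLM ℝ ℂ ℂ volume 2 G.T (𝓕 (classL2 volume fun w : ℝ => φ (2 * Real.pi * w)))

/-! ### The operators `B`, `R`, `Q` -/

/-- The measure `dλ / (f(λ) + g(λ))`. -/
def invMeasure (f g : ℝ → ℝ) : Measure ℝ :=
  volume.withDensity fun l => (ENNReal.ofReal (f l + g l))⁻¹

theorem quasi : Measure.QuasiMeasurePreserving (fun l : ℝ => l / (2 * Real.pi)) volume volume := by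
  refine ⟨by fun_prop, ?_⟩
  have h : (2 * Real.pi)⁻¹ ≠ 0 := by positivity
  simp only [div_eq_mul_inv]
  rw [Real.map_volume_mul_right h]
  exact Measure.smul_absolutelyContinuous

theorem ac (f g : ℝ → ℝ) : invMeasure f g ≪ volume := withDensity_absolutelyContinuous _ _

theorem fourierPlus_add (f g : ℝ → ℝ) (x y : G.L2T) :
    G.fourierPlus (x + y) =ᵐ[invMeasure f g] G.fourierPlus x + G.fourierPlus y := by
  have h : 𝓕⁻ (G.extend (x + y)) = 𝓕⁻ (G.extend x) + 𝓕⁻ (G.extend y) := by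
    rw [extend_add, FourierTransform.fourierInv_add]
  have h2 := quasi.ae (Lp.coeFn_add (𝓕⁻ (G.extend x)) (𝓕⁻ (G.extend y)))
  filter_upwards [(ac f g).ae_le h2] with l hl
  simp only [fourierPlus, h, Pi.add_apply]
  exact hl

theorem fourierPlus_smul (f g : ℝ → ℝ) (c : ℂ) (x : G.L2T) :
    G.fourierPlus (c • x) =ᵐ[invMeasure f g] c • G.fourierPlus x := by
  have h : 𝓕⁻ (G.extend (c • x)) = c • 𝓕⁻ (G.extend x) := by
    rw [extend_smul, FourierTransform.fourierInv_smul]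
  have h2 := quasi.ae (Lp.coeFn_smul c (𝓕⁻ (G.extend x)))
  filter_upwards [(ac f g).ae_le h2] with l hl
  simp only [fourierPlus, h, Pi.smul_apply]
  exact hl

/-- The form domain of `B`: all `x ∈ L₂(T)` with
`∫ |∫_T x(u) e^{iuλ} du|² / (f(λ) + g(λ)) dλ < ∞`. -/
def formDomain (f g : ℝ → ℝ) : Submodule ℂ G.L2T where
  carrier := {x | MemLp (G.fourierPlus x) 2 (invMeasure f g)}
  add_mem' {x y} hx hy := (memLp_congr_ae (G.fourierPlus_add f g x y)).2 (hx.add hy)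
  zero_mem' := by
    have h := G.fourierPlus_smul f g 0 0
    rw [zero_smul, zero_smul] at h
    exact (memLp_congr_ae h).2 MemLp.zero
  smul_mem' c x hx := (memLp_congr_ae (G.fourierPlus_smul f g c x)).2 (hx.const_smul c)

/-- The quadratic form of `B`, conjugate-linear in the first argument:
`(1/2π) ∫ conj (∫_T y(u) e^{iuλ} du) (∫_T x(u) e^{iuλ} du) / (f(λ) + g(λ)) dλ`. -/
def form (f g : ℝ → ℝ) (y x : G.L2T) : ℂ :=
  (1 / (2 * Real.pi) : ℂ) * ∫ l, conj (G.fourierPlus y l) * G.fourierPlus x l ∂(invMeasure f g)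

theorem form_integrable (f g : ℝ → ℝ) {x y : G.L2T} (hx : x ∈ G.formDomain f g)
    (hy : y ∈ G.formDomain f g) :
    Integrable (fun l => conj (G.fourierPlus y l) * G.fourierPlus x l) (invMeasure f g) :=
  MemLp.integrable_mul (p := 2) (q := 2) (MemLp.star hy) hx

theorem form_add (f g : ℝ → ℝ) {x x' y : G.L2T} (hx : x ∈ G.formDomain f g)
    (hx' : x' ∈ G.formDomain f g) (hy : y ∈ G.formDomain f g) :
    G.form f g y (x + x') = G.form f g y x + G.form f g y x' := by
  unfold form
  rw [← mul_add, ← integral_add (G.form_integrable f g hx hy) (G.form_integrable f g hx' hy)]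
  congr 1
  refine integral_congr_ae ?_
  filter_upwards [G.fourierPlus_add f g x x'] with l hl
  rw [hl, Pi.add_apply, mul_add]

theorem form_smul (f g : ℝ → ℝ) (c : ℂ) (y x : G.L2T) :
    G.form f g y (c • x) = c * G.form f g y x := by
  unfold form
  rw [mul_left_comm c]
  congr 1
  have h := integral_const_mul (μ := invMeasure f g) c
    fun l => conj (G.fourierPlus y l) * G.fourierPlus x l
  rw [← h]
  refine integral_congr_ae ?_
  filter_upwards [G.fourierPlus_smul f g c x] with l hl
  rw [hl, Pi.smul_apply, smul_eq_mul, mul_left_comm]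

/-- The graph of `B`. -/
def graphB (f g : ℝ → ℝ) : Submodule ℂ (G.L2T × G.L2T) where
  carrier := {p | p.1 ∈ G.formDomain f g ∧
    ∀ y ∈ G.formDomain f g, G.form f g y p.1 = inner ℂ y p.2}
  add_mem' {p q} hp hq := by
    refine ⟨add_mem hp.1 hq.1, fun y hy => ?_⟩
    rw [Prod.fst_add, Prod.snd_add, G.form_add f g hp.1 hq.1 hy, hp.2 y hy, hq.2 y hy,
      inner_add_right]
  zero_mem' := by
    refine ⟨zero_mem _, fun y _ => ?_⟩
    have h := G.form_smul f g 0 y 0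
    rw [zero_smul, zero_mul] at h
    simpa using h
  smul_mem' c p hp := by
    refine ⟨Submodule.smul_mem _ c hp.1, fun y hy => ?_⟩
    rw [Prod.smul_fst, Prod.smul_snd, G.form_smul, hp.2 y hy, inner_smul_right]

/-- The operator
`(B x)(t) = (1/2π) ∫_T x(u) ∫ e^{iλ(u-t)} / (f(λ) + g(λ)) dλ du`, `t ∈ T`, in `L₂(T)`.
As `f + g` is integrable, `1 / (f + g)` never is, so that `B` is an unbounded operator: it is the
operator in `L₂(T)` of the quadratic form
`⟨B x, x⟩ = (1/2π) ∫ |∫_T x(u) e^{iuλ} du|² / (f(λ) + g(λ)) dλ`, that is, `B x = r` means that `x`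
lies in the form domain and `form y x = ⟨y, r⟩` for all `y` in the form domain. -/
def opB (f g : ℝ → ℝ) : G.L2T →ₗ.[ℂ] G.L2T := (G.graphB f g).toLinearPMap

/-- `B` is invertible in `L₂(T)`: a bijection of its domain onto `L₂(T)`. -/
def InvertibleB (f g : ℝ → ℝ) : Prop := Function.Bijective (G.opB f g).toFun

/-- The inverse operator `B⁻¹ : L₂(T) → L₂(T)` of an invertible `B`. -/
def invB {f g : ℝ → ℝ} (hB : G.InvertibleB f g) (r : G.L2T) : G.L2T :=
  ((LinearEquiv.ofBijective (G.opB f g).toFun hB).symm r : (G.opB f g).domain)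

/-- The operator
`(R x)(t) = (1/2π) ∫_T x(u) ∫ e^{-iλ(u+t)} f(λ) / (f(λ) + g(λ)) dλ du`, `t ∈ T`, in `L₂(T)`
(the integration over `u` being performed first, and the integrals in the sense of Plancherel). -/
def opR (f g : ℝ → ℝ) (x : G.L2T) : G.L2T :=
  G.synth fun l => (f l / (f l + g l) : ℝ) * G.fourierMinus x l

/-- The operator
`(Q x)(t) = (1/2π) ∫_T x(u) ∫ e^{iλ(t-u)} f(λ) g(λ) / (f(λ) + g(λ)) dλ du`, `t ∈ T`. -/
def opQ (f g : ℝ → ℝ) (x : G.L2T) (t : ℝ) : ℂ :=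
  (1 / (2 * Real.pi) : ℂ) * ∫ u in G.T, x u *
    ∫ l : ℝ, expFun (t - u) l * (f l * g l / (f l + g l) : ℝ)

/-! ### The functional and its optimal estimate -/

theorem memLp_bold (a : ℝ → ℂ) (ha : MemLp a 2 (volume.restrict G.R)) :
    MemLp (G.R.indicator a) 2 (volume.restrict G.T) := by
  rw [memLp_indicator_iff_restrict G.measurableSet_R,
    Measure.restrict_restrict G.measurableSet_R,
    Set.inter_eq_left.2 (show G.R ⊆ G.T from fun t ht => Set.mem_union_right _ ht.1)]
  exact ha

/-- The element `𝐚` of `L₂(T)`: `𝐚 = a` on `R^s`, `𝐚 = 0` on `S` and on `S⁺`. -/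
def bold (a : ℝ → ℂ) (ha : MemLp a 2 (volume.restrict G.R)) : G.L2T :=
  (G.memLp_bold a ha).toLp (G.R.indicator a)

/-- `A(e^{iλ}) = ∫_{R^s} a(t) e^{-itλ} dt`. -/
def symbolA (a : ℝ → ℂ) (l : ℝ) : ℂ := ∫ t in G.R, a t * expFun (-t) l

/-- The functional `Aξ = ∫_{R^s} a(t) ξ(-t) dt`, a mean-square integral. -/
def functional {Ω : Type*} [MeasurableSpace Ω] (P : Measure Ω) (ξ : ℝ → Ω → ℂ) (a : ℝ → ℂ) :
    Lp ℂ 2 P :=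
  ∫ t in G.R, a t • classL2 P (ξ (-t))

/-- `H^s(ζ)`: the closed span in `L₂(P)` of `ζ(t)`, `t ∈ ℝ⁻ \ S`. -/
def obsSpace {Ω : Type*} [MeasurableSpace Ω] (P : Measure Ω) (ζ : ℝ → Ω → ℂ) :
    Submodule ℂ (Lp ℂ 2 P) :=
  (Submodule.span ℂ ((fun t => classL2 P (ζ t)) '' G.obs)).topologicalClosure

instance {Ω : Type*} [MeasurableSpace Ω] (P : Measure Ω) (ζ : ℝ → Ω → ℂ) :
    CompleteSpace (G.obsSpace P ζ) :=
  (Submodule.isClosed_topologicalClosure _).completeSpace_coe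

/-- `L_2^s(f + g)`: the closed span in `L₂(f + g)` of `e^{itλ}`, `t ∈ ℝ⁻ \ S`. -/
def specSpace (f g : ℝ → ℝ) : Submodule ℂ (Lp ℂ 2 (specMeasure (f + g))) :=
  (Submodule.span ℂ
    ((fun t => classL2 (specMeasure (f + g)) (expFun t)) '' G.obs)).topologicalClosure

/-- The mean-square optimal linear estimate of `Aξ` from the observations `ξ(t) + η(t)`,
`t ∈ ℝ⁻ \ S`: the orthogonal projection of `Aξ` onto `H^s(ξ + η)`. -/
def estimate {Ω : Type*} [MeasurableSpace Ω] (P : Measure Ω) (ξ η : ℝ → Ω → ℂ) (a : ℝ → ℂ) :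
    Lp ℂ 2 P :=
  (G.obsSpace P (ξ + η)).starProjection (G.functional P ξ a)

/-- `h` is the spectral characteristic of `X`: `h ∈ L_2^s(f + g)` and
`X = ∫ h(λ) (Z_ξ(dλ) + Z_η(dλ))`. -/
def IsSpectralCharacteristic {Ω : Type*} [MeasurableSpace Ω] (P : Measure Ω) (ξ η : ℝ → Ω → ℂ)
    (f g : ℝ → ℝ) (h : ℝ → ℂ) (X : Lp ℂ 2 P) : Prop :=
  MemLp h 2 (specMeasure (f + g)) ∧
  classL2 (specMeasure (f + g)) h ∈ G.specSpace f g ∧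
  X = spectralIntegral P ξ f h + spectralIntegral P η g h

end Gaps

end Filtering

end

noncomputable section

namespace Filtering

/-! ### Exponentials -/

/-! The stochastic integrals are isometries, and the ranges for `ξ` and `η` are orthogonal, so the
problem moves to weighted spaces on the line: `h` is the spectral characteristic once (i) `A f - h
(f + g)` is orthogonal in `L₂(dλ)` to `e^{itλ}` for every observation time `t`, and (ii) `h` lies in
the closed span of these exponentials in `L₂(f + g)`.

For `h = (A f - C)/(f + g)` the function in (i) is `C`, the transform of an element of `L₂(T)`. It
is integrable, so its inverse transform is continuous; vanishing almost everywhere on the open set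
of observation times, it vanishes at each of them (`integral_fourierPlus_mul_expFun`).

For (ii), let `φ` be orthogonal to the exponentials and put `F = φ (f + g)`. Then `F` is integrable,
lies in `L₂(dλ/(f + g))` and has spectrum in `T`. If `F` is the transform of some `y` in `L₂(T)`,
then `y` is in the form domain, and testing `B c = R a` against `y` says exactly that `φ` is
orthogonal to `h`. This is `classL2_characteristic_mem`.

The obstacle is that `F` need not be in `L₂(dλ)` a priori, since `f + g` may be unbounded.
Invertibility of `B` removes it (`memLp_two_of_integral_expFun`). The inverse is symmetric and
everywhere defined, hence bounded, so the form of `B` dominates the `L₂(T)` norm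
(`exists_norm_sq_le`). Multiplying `F`, after a shift, by Szegő extremal functions `m` with `|m|² =
1/(1 + ε(1 + λ²)|F|)` gives square-integrable functions whose spectrum stays one-sided
(`exists_multiplier`). The form bound holds for them uniformly in `ε`, and Fatou's lemma as `ε → 0`
gives `F ∈ L₂`.

The first error formula is Pythagoras for the `ξ` and `η` parts of the error; the second is `Δ = ⟨Aξ
- Âξ, Aξ⟩` written on the spectral side. -/

theorem continuous_expFun (t : ℝ) : Continuous (expFun t) := by
  unfold expFun; fun_prop

theorem continuous_expFun_left (l : ℝ) : Continuous fun t => expFun t l := by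
  unfold expFun; fun_prop

theorem continuous_uncurry_expFun : Continuous fun q : ℝ × ℝ => expFun q.1 q.2 := by
  unfold expFun; fun_prop

@[simp] theorem norm_expFun (t l : ℝ) : ‖expFun t l‖ = 1 := by
  have h : I * (t : ℂ) * l = ((t * l : ℝ) : ℂ) * I := by push_cast; ring
  rw [expFun, h, norm_exp_ofReal_mul_I]

theorem expFun_add (t u l : ℝ) : expFun (t + u) l = expFun t l * expFun u l := by
  simp only [expFun, ← Complex.exp_add]; congr 1; push_cast; ring

@[simp] theorem expFun_zero (l : ℝ) : expFun 0 l = 1 := by simp [expFun]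

@[simp] theorem conj_expFun (t l : ℝ) : conj (expFun t l) = expFun (-t) l := by
  simp only [expFun, ← Complex.exp_conj]; congr 1; simp

theorem integrable_mul_expFun {μ : Measure ℝ} {F : ℝ → ℂ} (hF : Integrable F μ) (t : ℝ) :
    Integrable (fun l => F l * expFun t l) μ :=
  hF.mul_bdd (c := 1) (continuous_expFun t).aestronglyMeasurable (by simp)

theorem fourier_eq_integral_expFun (u : ℝ → ℂ) (w : ℝ) :
    𝓕 u w = ∫ v, u v * expFun (-(2 * Real.pi * w)) v := by
  rw [Real.fourier_real_eq_integral_exp_smul]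
  refine integral_congr_ae (.of_forall fun v => ?_)
  simp only [expFun, smul_eq_mul, mul_comm (u v)]
  congr 2; push_cast; ring

/-! ### Fourier transforms of integrable functions -/

/-- Real smooth bumps, viewed as complex Schwartz functions, are already enough test functions. This
turns identities of tempered distributions into almost-everywhere identities. -/
theorem ae_eq_of_integral_schwartz {u v : ℝ → ℂ} (hu : LocallyIntegrable u)
    (hv : LocallyIntegrable v)
    (hui : ∀ ψ : SchwartzMap ℝ ℂ, HasCompactSupport ψ → ∫ x, ψ x * u x = ∫ x, ψ x * v x) :
    u =ᵐ[volume] v := by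
  have key : (fun x => u x - v x) =ᵐ[volume] 0 := by
    refine ae_eq_zero_of_integral_contDiff_smul_eq_zero (hu.sub hv) fun g hg hgc => ?_
    have hg₁ : HasCompactSupport (Complex.ofRealCLM ∘ g) := hgc.comp_left rfl
    have hg₂ : ContDiff ℝ (⊤ : ℕ∞) (Complex.ofRealCLM ∘ g) := by fun_prop
    have h := hui (hg₁.toSchwartzMap hg₂) hg₁
    have e : ∀ x, (hg₁.toSchwartzMap hg₂) x = (g x : ℂ) := fun x => rfl
    simp only [e] at h
    have hc : Continuous fun x => (g x : ℂ) := by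
      have := hg.continuous; fun_prop
    have hiu : Integrable fun x => (g x : ℂ) * u x := by
      simpa using hu.integrable_smul_left_of_hasCompactSupport hc hg₁
    have hiv : Integrable fun x => (g x : ℂ) * v x := by
      simpa using hv.integrable_smul_left_of_hasCompactSupport hc hg₁
    simp only [real_smul, mul_sub]
    rw [integral_sub hiu hiv, h, sub_self]
  filter_upwards [key] with x hx
  exact sub_eq_zero.1 hx

theorem integral_fourier_mul {u v : ℝ → ℂ} (hu : Integrable u) (hv : Integrable v) :
    ∫ x, 𝓕 u x * v x = ∫ x, u x * 𝓕 v x := by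
  have := VectorFourier.integral_fourierIntegral_smul_eq_flip (L := innerₗ ℝ)
    Real.continuous_fourierChar continuous_inner hu hv
  simpa using! this

/-- Every Schwartz function is a Fourier transform, and the transform can be moved onto `F`, where
it is zero. -/
theorem ae_eq_zero_of_integral_expFun {F : ℝ → ℂ} (hF : Integrable F)
    (h : ∀ t, ∫ l, F l * expFun t l = 0) : F =ᵐ[volume] 0 := by
  have h0 : 𝓕 F = 0 := by
    ext w; rw [fourier_eq_integral_expFun, h]; rfl
  refine ae_eq_of_integral_schwartz hF.locallyIntegrable (locallyIntegrable_zero) fun ψ _ => ?_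
  have := integral_fourier_mul (𝓕⁻ ψ).integrable hF
  rw [h0] at this
  simpa [← SchwartzMap.fourier_coe] using this

theorem continuous_integral_expFun {μ : Measure ℝ} {F : ℝ → ℂ} (hF : Integrable F μ) :
    Continuous fun t => ∫ l, F l * expFun t l ∂μ := by
  refine continuous_of_dominated (bound := fun l => ‖F l‖)
    (fun t => (integrable_mul_expFun hF t).aestronglyMeasurable) (fun t => .of_forall fun l => ?_)
    hF.norm (.of_forall fun l => ?_)
  · simp
  · exact continuous_const.mul (continuous_expFun_left l)

theorem continuous_fourier {u : ℝ → ℂ} (hu : Integrable u) : Continuous (𝓕 u) := by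
  have := (continuous_integral_expFun hu).comp
    (show Continuous fun w : ℝ => -(2 * Real.pi * w) by fun_prop)
  convert this using 1
  ext w; rw [fourier_eq_integral_expFun]; rfl

/-- On `L₁ ∩ L₂` the Plancherel transform is given by the integral. -/
theorem coeFn_fourier_toLp {u : ℝ → ℂ} (hu : Integrable u) (hu2 : MemLp u 2) :
    (𝓕 (hu2.toLp u) : Lp ℂ 2 (volume : Measure ℝ)) =ᵐ[volume] 𝓕 u := by
  refine ae_eq_of_integral_schwartz ((Lp.memLp _).locallyIntegrable (by norm_num))
    (continuous_fourier hu).locallyIntegrable fun ψ _ => ?_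
  have h := congrArg (fun d => d ψ) (Lp.fourier_toTemperedDistribution_eq (hu2.toLp u))
  simp only [TemperedDistribution.fourier_apply, Lp.toTemperedDistribution_apply] at h
  simp only [smul_eq_mul] at h
  rw [← h, ← integral_fourier_mul ψ.integrable hu]
  refine integral_congr_ae ?_
  filter_upwards [hu2.coeFn_toLp] with x hx
  rw [hx, SchwartzMap.fourier_coe]

/-! ### Classes of square-integrable functions -/

section classL2

variable {X : Type*} [MeasurableSpace X] {μ ν : Measure X} {u v : X → ℂ}

theorem classL2_eq (h : MemLp u 2 μ) : classL2 μ u = h.toLp u := dif_pos h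

theorem coeFn_classL2 (h : MemLp u 2 μ) : classL2 μ u =ᵐ[μ] u := by
  rw [classL2_eq h]; exact h.coeFn_toLp

@[simp] theorem classL2_coe (x : Lp ℂ 2 μ) : classL2 μ x = x := by
  rw [classL2_eq (Lp.memLp x), Lp.toLp_coeFn]

theorem classL2_add (hu : MemLp u 2 μ) (hv : MemLp v 2 μ) :
    classL2 μ (u + v) = classL2 μ u + classL2 μ v := by
  rw [classL2_eq hu, classL2_eq hv, classL2_eq (hu.add hv)]; rfl

theorem classL2_sub (hu : MemLp u 2 μ) (hv : MemLp v 2 μ) :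
    classL2 μ (u - v) = classL2 μ u - classL2 μ v := by
  rw [classL2_eq hu, classL2_eq hv, classL2_eq (hu.sub hv)]; rfl

theorem inner_classL2 (hu : MemLp u 2 μ) (hv : MemLp v 2 μ) :
    inner ℂ (classL2 μ u) (classL2 μ v) = ∫ x, conj (u x) * v x ∂μ := by
  rw [L2.inner_def]
  refine integral_congr_ae ?_
  filter_upwards [coeFn_classL2 hu, coeFn_classL2 hv] with x h1 h2
  rw [h1, h2, RCLike.inner_apply, mul_comm]

theorem norm_sq_eq_integral (x : Lp ℂ 2 μ) : ‖x‖ ^ 2 = ∫ t, ‖x t‖ ^ 2 ∂μ := by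
  have h := inner_self_eq_norm_sq_to_K (𝕜 := ℂ) x
  rw [L2.inner_def] at h
  simp only [inner_self_eq_norm_sq_to_K] at h
  have h2 : ((∫ t, ‖x t‖ ^ 2 ∂μ : ℝ) : ℂ) = ((‖x‖ ^ 2 : ℝ) : ℂ) := by
    rw [← integral_complex_ofReal]; push_cast; exact h
  exact_mod_cast h2.symm

theorem norm_sq_classL2 (hu : MemLp u 2 μ) : ‖classL2 μ u‖ ^ 2 = ∫ t, ‖u t‖ ^ 2 ∂μ := by
  rw [norm_sq_eq_integral]
  refine integral_congr_ae ?_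
  filter_upwards [coeFn_classL2 hu] with x h1
  rw [h1]

/-- The contraction `L₂(ν) → L₂(μ)` for `μ ≤ ν`. -/
def smallerMeasure (h : μ ≤ ν) : Lp ℂ 2 ν →L[ℂ] Lp ℂ 2 μ :=
  LinearMap.mkContinuous
    { toFun := fun x => ((Lp.memLp x).mono_measure h).toLp x
      map_add' := fun x y => by
        rw [← MemLp.toLp_add]
        exact MemLp.toLp_congr _ _ (ae_mono h (Lp.coeFn_add x y))
      map_smul' := fun c x => by
        rw [RingHom.id_apply, ← MemLp.toLp_const_smul]
        exact MemLp.toLp_congr _ _ (ae_mono h (Lp.coeFn_smul c x)) } 1 fun x => by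
      simp only [LinearMap.coe_mk, AddHom.coe_mk, one_mul]
      rw [Lp.norm_toLp, Lp.norm_def]
      exact ENNReal.toReal_mono (Lp.eLpNorm_ne_top x) (eLpNorm_mono_measure _ h)

theorem smallerMeasure_classL2 (h : μ ≤ ν) (hu : MemLp u 2 ν) :
    smallerMeasure h (classL2 ν u) = classL2 μ u := by
  rw [classL2_eq (hu.mono_measure h)]
  exact MemLp.toLp_congr ((Lp.memLp (classL2 ν u)).mono_measure h) _
    (ae_mono h (coeFn_classL2 hu))

end classL2

/-! ### Spectral measures -/

section specMeasure

variable {f g : ℝ → ℝ}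

theorem integral_specMeasure (hf : Integrable f) (hf0 : ∀ l, 0 ≤ f l) (u : ℝ → ℂ) :
    ∫ l, u l ∂(specMeasure f) = (1 / (2 * Real.pi) : ℂ) * ∫ l, u l * f l := by
  unfold specMeasure
  rw [integral_withDensity_eq_integral_toReal_smul₀
    ((hf.aestronglyMeasurable.aemeasurable.div_const _).ennreal_ofReal)
    (.of_forall fun _ => ENNReal.ofReal_lt_top), ← integral_const_mul]
  refine integral_congr_ae (.of_forall fun l => ?_)
  have : 0 ≤ f l / (2 * Real.pi) := div_nonneg (hf0 l) (by positivity)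
  simp only [ENNReal.toReal_ofReal this, real_smul]
  push_cast; ring

theorem integral_specMeasure_real (hf : Integrable f) (hf0 : ∀ l, 0 ≤ f l) (u : ℝ → ℝ) :
    ∫ l, u l ∂(specMeasure f) = 1 / (2 * Real.pi) * ∫ l, u l * f l := by
  unfold specMeasure
  rw [integral_withDensity_eq_integral_toReal_smul₀
    ((hf.aestronglyMeasurable.aemeasurable.div_const _).ennreal_ofReal)
    (.of_forall fun _ => ENNReal.ofReal_lt_top), ← integral_const_mul]
  refine integral_congr_ae (.of_forall fun l => ?_)
  have : 0 ≤ f l / (2 * Real.pi) := div_nonneg (hf0 l) (by positivity)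
  simp only [ENNReal.toReal_ofReal this, smul_eq_mul]
  ring

theorem integrable_specMeasure_iff {E : Type*} [NormedAddCommGroup E] [NormedSpace ℝ E]
    (hf : Integrable f) (hf0 : ∀ l, 0 ≤ f l) (u : ℝ → E) :
    Integrable u (specMeasure f) ↔ Integrable fun l => f l • u l := by
  unfold specMeasure
  rw [integrable_withDensity_iff_integrable_smul₀'
    ((hf.aestronglyMeasurable.aemeasurable.div_const _).ennreal_ofReal)
    (.of_forall fun _ => ENNReal.ofReal_lt_top)]
  have : ∀ l, (ENNReal.ofReal (f l / (2 * Real.pi))).toReal • u l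
      = (2 * Real.pi)⁻¹ • f l • u l := fun l => by
    rw [ENNReal.toReal_ofReal (div_nonneg (hf0 l) (by positivity)), smul_smul]
    congr 1; ring
  simp only [this]
  exact integrable_smul_iff (by positivity) _

theorem isFiniteMeasure_specMeasure (hf : Integrable f) : IsFiniteMeasure (specMeasure f) :=
  isFiniteMeasure_withDensity_ofReal (hf.div_const _).2

theorem specMeasure_ac (f : ℝ → ℝ) : specMeasure f ≪ volume := withDensity_absolutelyContinuous _ _

theorem specMeasure_le_add_right (hg0 : ∀ l, 0 ≤ g l) : specMeasure f ≤ specMeasure (f + g) :=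
  withDensity_mono (.of_forall fun l => ENNReal.ofReal_le_ofReal (by
    have := hg0 l; rw [Pi.add_apply]; gcongr; linarith))

theorem specMeasure_le_add_left (hf0 : ∀ l, 0 ≤ f l) : specMeasure g ≤ specMeasure (f + g) := by
  rw [add_comm]; exact specMeasure_le_add_right hf0

theorem memLp_of_bounded {μ : Measure ℝ} [IsFiniteMeasure μ] {u : ℝ → ℂ}
    (hu : AEStronglyMeasurable u μ)
    (C : ℝ) (h : ∀ l, ‖u l‖ ≤ C) : MemLp u 2 μ :=
  MemLp.of_bound hu C (.of_forall h)

theorem memLp_expFun (hf : Integrable f) (t : ℝ) : MemLp (expFun t) 2 (specMeasure f) :=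
  have := isFiniteMeasure_specMeasure hf
  memLp_of_bounded (continuous_expFun t).aestronglyMeasurable 1 (by simp)

theorem inner_expFun (hf : Integrable f) (hf0 : ∀ l, 0 ≤ f l) {u : ℝ → ℂ}
    (hu : MemLp u 2 (specMeasure f)) (t : ℝ) :
    inner ℂ (classL2 (specMeasure f) (expFun t)) (classL2 (specMeasure f) u) =
      (1 / (2 * Real.pi) : ℂ) * ∫ l, u l * f l * expFun (-t) l := by
  rw [inner_classL2 (memLp_expFun hf t) hu, integral_specMeasure hf hf0]
  congr 2; ext l; rw [conj_expFun]; ring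

theorem integrable_mul_density (hf : Integrable f) (hf0 : ∀ l, 0 ≤ f l) {u : ℝ → ℂ}
    (hu : MemLp u 2 (specMeasure f)) : Integrable fun l => u l * f l := by
  have := isFiniteMeasure_specMeasure hf
  have h := (integrable_specMeasure_iff hf hf0 u).1 (hu.integrable (by norm_num))
  simpa [mul_comm] using h

theorem ae_specMeasure_of_mul {u : ℝ → ℂ} (hf : Integrable f)
    (h : ∀ᵐ l, u l * f l = 0) : ∀ᵐ l ∂(specMeasure f), u l = 0 := by
  unfold specMeasure
  rw [ae_withDensity_iff' ((hf.aestronglyMeasurable.aemeasurable.div_const _).ennreal_ofReal)]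
  filter_upwards [h] with l hl h0
  rcases mul_eq_zero.1 hl with h | h
  · exact h
  · have : f l = 0 := by exact_mod_cast h
    simp [this] at h0

/-- If `v` is orthogonal to all exponentials, the integrable function `v f` has zero Fourier
transform, so `v` vanishes wherever `f > 0`. -/
theorem denseRange_expFun (hf : Integrable f) (hf0 : ∀ l, 0 ≤ f l) :
    DenseRange (Finsupp.linearCombination ℂ fun t : ℝ => classL2 (specMeasure f) (expFun t)) := by
  have hr : Set.range (Finsupp.linearCombination ℂ fun t : ℝ => classL2 (specMeasure f) (expFun t))
      = (Submodule.span ℂ (Set.range fun t : ℝ => classL2 (specMeasure f) (expFun t)) :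
        Set (Lp ℂ 2 (specMeasure f))) := by
    rw [← Finsupp.range_linearCombination]; rfl
  rw [DenseRange, hr, Submodule.dense_iff_topologicalClosure_eq_top,
    Submodule.topologicalClosure_eq_top_iff, Submodule.eq_bot_iff]
  intro v hv
  rw [Submodule.mem_orthogonal] at hv
  have hint := integrable_mul_density hf hf0 (Lp.memLp v)
  have h0 := ae_eq_zero_of_integral_expFun hint fun t => by
    have h := hv _ (Submodule.subset_span ⟨-t, rfl⟩)
    have h' := inner_expFun hf hf0 (Lp.memLp v) (-t)
    simp only [classL2_coe] at h'
    rw [h, neg_neg, eq_comm, mul_eq_zero] at h'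
    refine h'.resolve_left ?_
    have := Real.pi_ne_zero
    simp [this]
  rw [Lp.eq_zero_iff_ae_eq_zero]
  exact ae_specMeasure_of_mul hf h0

end specMeasure

/-! ### Stochastic integrals -/

theorem inner_linearCombination_congr {ι E F : Type*} [NormedAddCommGroup E] [InnerProductSpace ℂ E]
    [NormedAddCommGroup F] [InnerProductSpace ℂ F] {x : ι → E} {y : ι → F}
    (h : ∀ i j, inner ℂ (x i) (x j) = inner ℂ (y i) (y j)) (c d : ι →₀ ℂ) :
    inner ℂ (Finsupp.linearCombination ℂ x c) (Finsupp.linearCombination ℂ x d) =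
      inner ℂ (Finsupp.linearCombination ℂ y c) (Finsupp.linearCombination ℂ y d) := by
  simp only [Finsupp.linearCombination_apply, Finsupp.sum, sum_inner, inner_sum, inner_smul_left,
    inner_smul_right, h]

section stationary

variable {Ω : Type*} [MeasurableSpace Ω] {P : Measure Ω} {ξ η : ℝ → Ω → ℂ} {f g : ℝ → ℝ}

namespace IsStationary

theorem inner_eq (hξ : IsStationary P ξ f) (t u : ℝ) :
    inner ℂ (classL2 P (ξ t)) (classL2 P (ξ u)) =
      inner ℂ (classL2 (specMeasure f) (expFun t)) (classL2 (specMeasure f) (expFun u)) := by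
  rw [inner_classL2 (hξ.memLp t) (hξ.memLp u), inner_expFun hξ.density_integrable
    hξ.density_nonneg (memLp_expFun hξ.density_integrable u)]
  simp only [mul_comm (conj _)]
  rw [hξ.covariance]
  congr 2; ext l
  rw [sub_eq_add_neg, expFun_add]; ring

theorem norm_linearCombination (hξ : IsStationary P ξ f) (c : ℝ →₀ ℂ) :
    ‖Finsupp.linearCombination ℂ (fun t : ℝ => classL2 P (ξ t)) c‖ =
      ‖Finsupp.linearCombination ℂ (fun t : ℝ => classL2 (specMeasure f) (expFun t)) c‖ := by
  have h := inner_linearCombination_congr hξ.inner_eq c c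
  rw [inner_self_eq_norm_sq_to_K, inner_self_eq_norm_sq_to_K] at h
  have h' : ‖Finsupp.linearCombination ℂ (fun t : ℝ => classL2 P (ξ t)) c‖ ^ 2 =
      ‖Finsupp.linearCombination ℂ (fun t : ℝ => classL2 (specMeasure f) (expFun t)) c‖ ^ 2 := by
    exact_mod_cast h
  exact (sq_eq_sq₀ (norm_nonneg _) (norm_nonneg _)).1 h'

/-- Density of the exponentials and the isometry on trigonometric sums (hence the constant 1) are
the two conditions under which `extendOfNorm` is a genuine extension. -/
theorem spectralMap_linearCombination (hξ : IsStationary P ξ f) (c : ℝ →₀ ℂ) :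
    spectralMap P ξ f
      (Finsupp.linearCombination ℂ (fun t : ℝ => classL2 (specMeasure f) (expFun t)) c) =
      Finsupp.linearCombination ℂ (fun t : ℝ => classL2 P (ξ t)) c :=
  LinearMap.extendOfNorm_eq (denseRange_expFun hξ.density_integrable hξ.density_nonneg)
    ⟨1, fun c => by rw [one_mul, hξ.norm_linearCombination]⟩ c

theorem spectralMap_expFun (hξ : IsStationary P ξ f) (t : ℝ) :
    spectralMap P ξ f (classL2 (specMeasure f) (expFun t)) = classL2 P (ξ t) := by
  simpa using hξ.spectralMap_linearCombination (Finsupp.single t 1)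

theorem norm_spectralMap (hξ : IsStationary P ξ f) (x : Lp ℂ 2 (specMeasure f)) :
    ‖spectralMap P ξ f x‖ = ‖x‖ := by
  refine (denseRange_expFun hξ.density_integrable hξ.density_nonneg).induction_on x
    (isClosed_eq (by fun_prop) (by fun_prop)) fun c => ?_
  rw [hξ.spectralMap_linearCombination, hξ.norm_linearCombination]

theorem inner_spectralMap (hξ : IsStationary P ξ f) (x y : Lp ℂ 2 (specMeasure f)) :
    inner ℂ (spectralMap P ξ f x) (spectralMap P ξ f y) = inner ℂ x y :=
  LinearIsometry.inner_map_map ⟨(spectralMap P ξ f).toLinearMap, hξ.norm_spectralMap⟩ x y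

theorem add [IsFiniteMeasure P] (hξ : IsStationary P ξ f) (hη : IsStationary P η g)
    (h : Uncorrelated P ξ η) : IsStationary P (ξ + η) (f + g) where
  memLp t := (hξ.memLp t).add (hη.memLp t)
  mean_zero t := by
    have := integral_add ((hξ.memLp t).integrable (by norm_num))
      ((hη.memLp t).integrable (by norm_num))
    simpa [hξ.mean_zero, hη.mean_zero] using this
  density_nonneg l := add_nonneg (hξ.density_nonneg l) (hη.density_nonneg l)
  density_integrable := hξ.density_integrable.add hη.density_integrable
  covariance t u := by
    have h' : ∫ ω, η t ω * conj (ξ u ω) ∂P = 0 := by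
      have := congrArg conj (h u t)
      rw [← integral_conj] at this
      simpa [mul_comm] using this
    have i : ∀ {a b : Ω → ℂ}, MemLp a 2 P → MemLp b 2 P → Integrable (fun ω => a ω * conj (b ω)) P :=
      fun ha hb => MemLp.integrable_mul (p := 2) (q := 2) ha (MemLp.star hb)
    have i1 := i (hξ.memLp t) (hξ.memLp u)
    have i2 := i (hξ.memLp t) (hη.memLp u)
    have i3 := i (hη.memLp t) (hξ.memLp u)
    have i4 := i (hη.memLp t) (hη.memLp u)
    have e : ∀ ω, (ξ + η) t ω * conj ((ξ + η) u ω) = (ξ t ω * conj (ξ u ω) + ξ t ω * conj (η u ω))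
        + (η t ω * conj (ξ u ω) + η t ω * conj (η u ω)) := fun ω => by
      simp only [Pi.add_apply, map_add]; ring
    have e2 : ∀ l, expFun (t - u) l * ((f + g) l : ℂ) =
        expFun (t - u) l * (f l : ℂ) + expFun (t - u) l * (g l : ℂ) := fun l => by
      simp only [Pi.add_apply]; push_cast; ring
    have j : ∀ {k : ℝ → ℝ}, Integrable k → Integrable fun l => expFun (t - u) l * (k l : ℂ) :=
      fun hk => (integrable_mul_expFun hk.ofReal (t - u)).congr
        (.of_forall fun l => mul_comm _ _)
    simp only [e, e2]
    have s1 := integral_add i1 i2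
    have s2 := integral_add i3 i4
    have s3 := integral_add (i1.add i2) (i3.add i4)
    simp only [Pi.add_apply] at s3
    rw [s3, s1, s2, hξ.covariance, hη.covariance, h, h', integral_add (j hξ.density_integrable)
      (j hη.density_integrable)]
    ring

theorem inner_spectralMap_of_uncorrelated (hξ : IsStationary P ξ f) (hη : IsStationary P η g)
    (h : Uncorrelated P ξ η) (x : Lp ℂ 2 (specMeasure f)) (y : Lp ℂ 2 (specMeasure g)) :
    inner ℂ (spectralMap P η g y) (spectralMap P ξ f x) = 0 := by
  refine (denseRange_expFun hξ.density_integrable hξ.density_nonneg).induction_on x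
    (isClosed_eq (by fun_prop) (by fun_prop)) fun c => ?_
  refine (denseRange_expFun hη.density_integrable hη.density_nonneg).induction_on y
    (isClosed_eq (by fun_prop) (by fun_prop)) fun d => ?_
  rw [hξ.spectralMap_linearCombination, hη.spectralMap_linearCombination]
  simp only [Finsupp.linearCombination_apply, Finsupp.sum, sum_inner, inner_sum, inner_smul_left,
    inner_smul_right, inner_classL2 (hη.memLp _) (hξ.memLp _), mul_comm (conj _), h _ _]
  simp

/-- Both sides are continuous in the class of `u` in `L₂(f + g)` and agree on exponentials. The
restriction maps to the smaller measures make the two integrals on the right continuous on that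
space. -/
theorem spectralIntegral_add [IsFiniteMeasure P] (hξ : IsStationary P ξ f) (hη : IsStationary P η g)
    (h : Uncorrelated P ξ η) {u : ℝ → ℂ} (hu : MemLp u 2 (specMeasure (f + g))) :
    spectralIntegral P (ξ + η) (f + g) u = spectralIntegral P ξ f u + spectralIntegral P η g u := by
  set F := spectralMap P ξ f ∘L smallerMeasure (specMeasure_le_add_right hη.density_nonneg)
  set E := spectralMap P η g ∘L smallerMeasure (specMeasure_le_add_left hξ.density_nonneg)
  have hS := hξ.add hη h
  have key : ∀ x, spectralMap P (ξ + η) (f + g) x = F x + E x := fun x => by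
    refine (denseRange_expFun hS.density_integrable hS.density_nonneg).induction_on x
      (isClosed_eq (by fun_prop) (by fun_prop)) fun c => ?_
    rw [hS.spectralMap_linearCombination]
    simp only [Finsupp.linearCombination_apply, Finsupp.sum, map_sum, map_smul,
      ← Finset.sum_add_distrib, ← smul_add]
    refine Finset.sum_congr rfl fun t _ => ?_
    have e := memLp_expFun hS.density_integrable t
    simp only [F, E, ContinuousLinearMap.comp_apply, smallerMeasure_classL2 _ e,
      hξ.spectralMap_expFun, hη.spectralMap_expFun]
    rw [← classL2_add (hξ.memLp t) (hη.memLp t)]; rfl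
  simp only [spectralIntegral, key, F, E, ContinuousLinearMap.comp_apply,
    smallerMeasure_classL2 _ hu]

end IsStationary

/-! ### The functional -/

/-- The squared distance expands into inner products, which are values of the continuous Fourier
transform of `f`. -/
theorem continuous_classL2_expFun (hf : Integrable f) (hf0 : ∀ l, 0 ≤ f l) :
    Continuous fun t => classL2 (specMeasure f) (expFun t) := by
  have hip : ∀ s t, inner ℂ (classL2 (specMeasure f) (expFun s)) (classL2 (specMeasure f) (expFun t))
      = (1 / (2 * Real.pi) : ℂ) * ∫ l, (f l : ℂ) * expFun (t - s) l := fun s t => by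
    rw [inner_expFun hf hf0 (memLp_expFun hf t)]
    congr 2; ext l; rw [sub_eq_add_neg, expFun_add]; ring
  have hc : Continuous fun t => (1 / (2 * Real.pi) : ℂ) * ∫ l, (f l : ℂ) * expFun t l :=
    continuous_const.mul (continuous_integral_expFun hf.ofReal)
  rw [continuous_iff_continuousAt]
  intro s
  rw [ContinuousAt, tendsto_iff_norm_sub_tendsto_zero]
  have h2 : Filter.Tendsto (fun t => ‖classL2 (specMeasure f) (expFun t)
      - classL2 (specMeasure f) (expFun s)‖ ^ 2) (nhds s) (nhds 0) := by
    have e : ∀ t, ‖classL2 (specMeasure f) (expFun t) - classL2 (specMeasure f) (expFun s)‖ ^ 2 =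
        RCLike.re ((1 / (2 * Real.pi) : ℂ) * ∫ l, (f l : ℂ) * expFun (t - t) l) - 2 *
        RCLike.re ((1 / (2 * Real.pi) : ℂ) * ∫ l, (f l : ℂ) * expFun (s - t) l) +
        RCLike.re ((1 / (2 * Real.pi) : ℂ) * ∫ l, (f l : ℂ) * expFun (s - s) l) := fun t => by
      rw [← hip, ← hip, ← hip, @norm_sub_sq ℂ, inner_self_eq_norm_sq, inner_self_eq_norm_sq]
    simp only [e]
    have hcc : Continuous fun t =>
        RCLike.re ((1 / (2 * Real.pi) : ℂ) * ∫ l, (f l : ℂ) * expFun (t - t) l) - 2 *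
        RCLike.re ((1 / (2 * Real.pi) : ℂ) * ∫ l, (f l : ℂ) * expFun (s - t) l) +
        RCLike.re ((1 / (2 * Real.pi) : ℂ) * ∫ l, (f l : ℂ) * expFun (s - s) l) := by
      have h1 := RCLike.continuous_re.comp (hc.comp (show Continuous fun t : ℝ => s - t by fun_prop))
      simp only [sub_self]
      exact (continuous_const.sub (continuous_const.mul h1)).add continuous_const
    convert hcc.tendsto s using 2
    ring
  have := h2.sqrt
  simpa [Real.sqrt_sq] using this

/-- The mean-square integral of the exponentials is the class of the pointwise integral. -/
theorem integral_smul_classL2_expFun (hf : Integrable f) (hf0 : ∀ l, 0 ≤ f l) {μ : Measure ℝ}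
    [SFinite μ] {a : ℝ → ℂ} (ha : Integrable a μ) :
    Integrable (fun t => a t • classL2 (specMeasure f) (expFun (-t))) μ ∧
    ∫ t, a t • classL2 (specMeasure f) (expFun (-t)) ∂μ =
      classL2 (specMeasure f) fun l => ∫ t, a t * expFun (-t) l ∂μ := by
  have := isFiniteMeasure_specMeasure hf
  have hcont : Continuous fun t : ℝ => classL2 (specMeasure f) (expFun (-t)) :=
    (continuous_classL2_expFun hf hf0).comp continuous_neg
  have hbd : ∀ t, ‖classL2 (specMeasure f) (expFun t)‖ = ‖classL2 (specMeasure f) (expFun 0)‖ := by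
    intro t
    have h1 := norm_sq_classL2 (memLp_expFun hf t)
    have h2 := norm_sq_classL2 (memLp_expFun hf 0)
    simp only [norm_expFun] at h1 h2
    exact (sq_eq_sq₀ (norm_nonneg _) (norm_nonneg _)).1 (h1.trans h2.symm)
  have hint : Integrable (fun t => a t • classL2 (specMeasure f) (expFun (-t))) μ :=
    ha.smul_bdd ‖classL2 (specMeasure f) (expFun 0)‖ hcont.aestronglyMeasurable
      (.of_forall fun t => (hbd _).le)
  have hsm : ∀ l, ∫ t, a t * expFun (-t) l ∂μ = ∫ t, a t * expFun (-l) t ∂μ := fun l => by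
    congr 1; ext t; simp only [expFun]; congr 2; push_cast; ring
  have hA : MemLp (fun l => ∫ t, a t * expFun (-t) l ∂μ) 2 (specMeasure f) := by
    refine memLp_of_bounded ?_ (∫ t, ‖a t‖ ∂μ) fun l => ?_
    · simp only [hsm]
      exact ((continuous_integral_expFun ha).comp continuous_neg).aestronglyMeasurable
    · refine (norm_integral_le_integral_norm _).trans_eq ?_
      simp
  -- Both sides are compared by pairing with an arbitrary `v`; the equality is then Fubini's
  -- theorem.
  refine ⟨hint, ext_inner_left ℂ fun v => ?_⟩
  rw [← integral_inner hint]
  have hv := (Lp.memLp v).integrable (by norm_num)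
  have e1 : ∀ t, inner ℂ v (a t • classL2 (specMeasure f) (expFun (-t))) =
      ∫ l, a t * expFun (-t) l * conj (v l) ∂(specMeasure f) := fun t => by
    rw [inner_smul_right]
    have := inner_classL2 (Lp.memLp v) (memLp_expFun hf (-t))
    rw [classL2_coe] at this
    rw [this, ← integral_const_mul]
    congr 1; ext l; ring
  have e2 := inner_classL2 (Lp.memLp v) hA
  rw [classL2_coe] at e2
  simp only [e1, e2]
  rw [integral_integral_swap]
  · refine integral_congr_ae (.of_forall fun l => ?_)
    simp only
    rw [integral_mul_const, mul_comm]
  · have hp : Integrable (fun q : ℝ × ℝ => a q.1 * conj (v q.2)) (μ.prod (specMeasure f)) :=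
      ha.mul_prod ((LinearIsometryEquiv.integrable_comp_iff (conjLIE)).2 hv)
    refine (hp.mul_bdd (c := 1) (g := fun q : ℝ × ℝ => expFun (-q.1) q.2) ?_ (by simp)).congr
      (.of_forall fun q => ?_)
    · exact (continuous_uncurry_expFun.comp
        ((continuous_neg.comp continuous_fst).prodMk continuous_snd)).aestronglyMeasurable
    · simp only [Function.uncurry]; ring

/-- A continuous linear map commutes with the Bochner integral, so the mean-square integral can be
computed on the spectral side. -/
theorem Gaps.functional_eq (G : Gaps) (hξ : IsStationary P ξ f) {a : ℝ → ℂ}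
    (ha : IntegrableOn a G.R) :
    G.functional P ξ a = spectralIntegral P ξ f (G.symbolA a) := by
  have h := integral_smul_classL2_expFun hξ.density_integrable hξ.density_nonneg ha
  unfold functional spectralIntegral
  change _ = spectralMap P ξ f (classL2 (specMeasure f) fun l => ∫ t in G.R, a t * expFun (-t) l)
  rw [← h.2, ← ContinuousLinearMap.integral_comp_comm _ h.1]
  simp only [map_smul, hξ.spectralMap_expFun]

theorem Gaps.continuous_symbolA (G : Gaps) {a : ℝ → ℂ} (ha : IntegrableOn a G.R) :
    Continuous (G.symbolA a) := by
  have := (continuous_integral_expFun ha).comp continuous_neg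
  convert this using 1
  ext l
  simp only [symbolA, Function.comp]
  congr 1; ext t; simp only [expFun]; congr 2; push_cast; ring

theorem Gaps.norm_symbolA_le (G : Gaps) (a : ℝ → ℂ) (l : ℝ) :
    ‖G.symbolA a l‖ ≤ ∫ t in G.R, ‖a t‖ :=
  (norm_integral_le_integral_norm _).trans_eq (by simp)

end stationary

/-! ### The Cayley transform of the line -/

/-- The map `λ ↦ (λ - i) / (λ + i)` of the real line into the unit circle. -/
def cayley (l : ℝ) : ℂ := (l - I) / (l + I)

theorem ofReal_add_I_ne_zero (l : ℝ) : (l : ℂ) + I ≠ 0 := fun h => by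
  simpa using congrArg Complex.im h

theorem continuous_cayley : Continuous cayley :=
  (by fun_prop : Continuous fun l : ℝ => (l : ℂ) - I).div (by fun_prop) ofReal_add_I_ne_zero

@[simp] theorem norm_cayley (l : ℝ) : ‖cayley l‖ = 1 := by
  have h : (l : ℂ) - I = conj ((l : ℂ) + I) := by simp [sub_eq_add_neg]
  rw [cayley, h, norm_div, RCLike.norm_conj, div_self (norm_ne_zero_iff.2 (ofReal_add_I_ne_zero l))]

theorem conj_mul_cayley (l : ℝ) : conj (cayley l) * cayley l = 1 := by
  rw [← Complex.normSq_eq_conj_mul_self, Complex.normSq_eq_norm_sq, norm_cayley]; simp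

theorem cayley_eq (l : ℝ) : cayley l = 1 - 2 * I / (l + I) := by
  have := ofReal_add_I_ne_zero l
  rw [cayley]; field_simp; ring

theorem injective_cayley : Function.Injective cayley := fun l m h => by
  have h1 := ofReal_add_I_ne_zero l
  have h2 := ofReal_add_I_ne_zero m
  rw [cayley_eq, cayley_eq, sub_right_inj, div_eq_div_iff h1 h2] at h
  have h3 := mul_left_cancel₀ (by simp : (2 * I : ℂ) ≠ 0) h
  exact_mod_cast (add_right_cancel h3).symm

/-- The Cayley transform as a bounded continuous function. -/
def cayleyBCF : BoundedContinuousFunction ℝ ℂ :=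
  .ofNormedAddCommGroup cayley continuous_cayley 1 fun l => (norm_cayley l).le

/-- On the unit circle `z z̄ = 1`, so products of `z` and `z̄` collapse to a single power of one of
them. -/
theorem exists_of_mem_closure_cayley {g : BoundedContinuousFunction ℝ ℂ}
    (hg : g ∈ Submonoid.closure ({cayleyBCF} ∪ star {cayleyBCF} :
      Set (BoundedContinuousFunction ℝ ℂ))) :
    ∃ n : ℕ, (∀ l, g l = cayley l ^ n) ∨ ∀ l, g l = conj (cayley l ^ n) := by
  induction hg using Submonoid.closure_induction with
  | mem x hx =>
    rcases hx with hx | hx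
    · exact ⟨1, .inl fun l => by rw [Set.mem_singleton_iff.1 hx, pow_one]; rfl⟩
    · rw [Set.star_singleton, Set.mem_singleton_iff] at hx
      exact ⟨1, .inr fun l => by rw [hx, pow_one]; rfl⟩
  | one => exact ⟨0, .inl fun l => by simp⟩
  | mul x y _ _ hx hy =>
    have e : ∀ (n m : ℕ) (l : ℝ), cayley l ^ n * conj (cayley l ^ m) =
        if m ≤ n then cayley l ^ (n - m) else conj (cayley l ^ (m - n)) := fun n m l => by
      have h := conj_mul_cayley l
      split_ifs with hmn
      · conv_lhs => rw [← Nat.sub_add_cancel hmn]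
        rw [pow_add, mul_assoc, map_pow, ← mul_pow, mul_comm (cayley l), h, one_pow, mul_one]
      · conv_lhs => rw [← Nat.sub_add_cancel (not_le.1 hmn).le]
        rw [pow_add, map_mul, mul_left_comm, map_pow _ _ n, ← mul_pow, mul_comm (cayley l), h,
          one_pow, mul_one]
    obtain ⟨n, hx⟩ := hx
    obtain ⟨m, hy⟩ := hy
    rcases hx with hx | hx <;> rcases hy with hy | hy
    · exact ⟨n + m, .inl fun l => by rw [BoundedContinuousFunction.mul_apply, hx, hy, pow_add]⟩
    · by_cases hmn : m ≤ n
      · exact ⟨n - m, .inl fun l => by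
          rw [BoundedContinuousFunction.mul_apply, hx, hy, e, if_pos hmn]⟩
      · exact ⟨m - n, .inr fun l => by
          rw [BoundedContinuousFunction.mul_apply, hx, hy, e, if_neg hmn]⟩
    · by_cases hmn : n ≤ m
      · exact ⟨m - n, .inl fun l => by
          rw [BoundedContinuousFunction.mul_apply, hx, hy, mul_comm, e, if_pos hmn]⟩
      · exact ⟨n - m, .inr fun l => by
          rw [BoundedContinuousFunction.mul_apply, hx, hy, mul_comm, e, if_neg hmn]⟩
    · exact ⟨n + m, .inr fun l => by
        rw [BoundedContinuousFunction.mul_apply, hx, hy, pow_add, map_mul]⟩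

/-- A nonnegative integrable function is determined by the integrals of the powers of the Cayley
transform against it. -/
theorem ae_eq_of_integral_cayley {u v : ℝ → ℝ} (hu : Integrable u) (hu0 : ∀ l, 0 ≤ u l)
    (hv : Integrable v) (hv0 : ∀ l, 0 ≤ v l)
    (h : ∀ n : ℕ, ∫ l, cayley l ^ n * u l = ∫ l, cayley l ^ n * v l) : u =ᵐ[volume] v := by
  have := isFiniteMeasure_specMeasure hu
  have := isFiniteMeasure_specMeasure hv
  have key : specMeasure u = specMeasure v := by
    -- Finite measures are determined by a point-separating star subalgebra; the one generated by
    -- the injective Cayley transform suffices.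
    refine ext_of_forall_mem_subalgebra_integral_eq_of_pseudoEMetric_complete_countable
      (𝕜 := ℂ) (A := StarAlgebra.adjoin ℂ {cayleyBCF}) ?_ fun g hg => ?_
    · intro x y hxy
      refine ⟨_, ⟨_, ⟨cayleyBCF, StarAlgebra.self_mem_adjoin_singleton ℂ _, rfl⟩, rfl⟩, ?_⟩
      exact fun h => hxy (injective_cayley h)
    · have hg' : g ∈ (StarAlgebra.adjoin ℂ {cayleyBCF}).toSubalgebra.toSubmodule := hg
      rw [StarAlgebra.adjoin_eq_span] at hg'
      induction hg' using Submodule.span_induction with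
      | mem x hx =>
        obtain ⟨n, hx | hx⟩ := exists_of_mem_closure_cayley hx
        · simp only [hx]
          rw [integral_specMeasure hu hu0, integral_specMeasure hv hv0, h]
        · simp only [hx]
          -- The densities are real, so the negative powers follow from the positive ones by
          -- conjugation.
          rw [integral_conj, integral_conj, integral_specMeasure hu hu0,
            integral_specMeasure hv hv0, h]
      | zero => simp
      | add x y hx hy h1 h2 =>
        have hx' : x ∈ StarAlgebra.adjoin ℂ {cayleyBCF} := by
          rw [← StarAlgebra.adjoin_eq_span] at hx; exact hx
        have hy' : y ∈ StarAlgebra.adjoin ℂ {cayleyBCF} := by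
          rw [← StarAlgebra.adjoin_eq_span] at hy; exact hy
        simp only [BoundedContinuousFunction.add_apply]
        rw [integral_add (x.integrable _) (y.integrable _),
          integral_add (x.integrable _) (y.integrable _), h1 hx', h2 hy']
      | smul c x hx h1 =>
        have hx' : x ∈ StarAlgebra.adjoin ℂ {cayleyBCF} := by
          rw [← StarAlgebra.adjoin_eq_span] at hx; exact hx
        simp only [BoundedContinuousFunction.smul_apply]
        rw [integral_smul, integral_smul, h1 hx']
  have hm : ∀ {w : ℝ → ℝ}, Integrable w →
      AEMeasurable (fun l => ENNReal.ofReal (w l / (2 * Real.pi))) := fun hw =>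
    (hw.aestronglyMeasurable.aemeasurable.div_const _).ennreal_ofReal
  have h2 := (withDensity_eq_iff_of_sigmaFinite (hm hu) (hm hv)).1 key
  filter_upwards [h2] with l hl
  have hpi : (0 : ℝ) < 2 * Real.pi := by positivity
  rw [ENNReal.ofReal_eq_ofReal_iff (div_nonneg (hu0 l) hpi.le) (div_nonneg (hv0 l) hpi.le)] at hl
  exact (div_left_inj' hpi.ne').1 hl

theorem hasDerivAt_cayley (l : ℝ) :
    HasDerivAt cayley (cayley l * (2 * I * ((1 + l ^ 2 : ℝ)⁻¹ : ℝ))) l := by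
  have h0 := ofReal_add_I_ne_zero l
  have h1 : HasDerivAt (fun l : ℝ => (l : ℂ) - I) 1 l := (Complex.ofRealCLM.hasDerivAt).sub_const I
  have h2 : HasDerivAt (fun l : ℝ => (l : ℂ) + I) 1 l := (Complex.ofRealCLM.hasDerivAt).add_const I
  refine (h1.div h2 h0).congr_deriv ?_
  have h3 : ((1 + l ^ 2 : ℝ) : ℂ) = (l - I) * (l + I) := by
    push_cast; ring_nf; rw [I_sq]; ring
  have h4 : (l : ℂ) - I ≠ 0 := fun h => by simpa using congrArg Complex.im h
  rw [ofReal_inv, h3, cayley]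
  field_simp
  ring

theorem tendsto_cayley : Filter.Tendsto cayley (Filter.cocompact ℝ) (nhds 1) := by
  have h : Filter.Tendsto (fun l : ℝ => 1 - 2 * I / (l + I)) (Filter.cocompact ℝ)
      (nhds (1 - 0)) := by
    refine tendsto_const_nhds.sub ?_
    rw [tendsto_zero_iff_norm_tendsto_zero]
    simp only [norm_div]
    refine Filter.Tendsto.div_atTop tendsto_const_nhds ?_
    refine Filter.tendsto_atTop_mono (f := fun l : ℝ => ‖l‖) (fun l => ?_)
      (tendsto_norm_cocompact_atTop)
    have := Complex.abs_re_le_norm ((l : ℂ) + I)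
    simpa using this
  rw [sub_zero] at h
  exact h.congr fun l => (cayley_eq l).symm

/-- Up to a nonzero constant the integrand is the derivative of `z^n`, and `z` has the same limit 1
at both ends of the line. Equivalently, `dλ/(1 + λ²)` corresponds to arc length on the circle. -/
theorem integral_cayley_pow {n : ℕ} (hn : 1 ≤ n) :
    ∫ l, cayley l ^ n * ((1 + l ^ 2 : ℝ)⁻¹ : ℝ) = 0 := by
  have hd : ∀ l, HasDerivAt (fun l => cayley l ^ n)
      ((n * 2 * I) * (cayley l ^ n * ((1 + l ^ 2 : ℝ)⁻¹ : ℝ))) l := fun l => by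
    refine ((hasDerivAt_cayley l).pow n).congr_deriv ?_
    obtain ⟨m, rfl⟩ : ∃ m, n = m + 1 := ⟨n - 1, by omega⟩
    rw [Nat.add_sub_cancel, pow_succ]; ring
  have hi : Integrable fun l : ℝ => cayley l ^ n * ((1 + l ^ 2 : ℝ)⁻¹ : ℝ) := by
    have := integrable_inv_one_add_sq.ofReal (𝕜 := ℂ)
    exact this.bdd_mul (c := 1) (continuous_cayley.pow n).aestronglyMeasurable (by simp)
  have ht := tendsto_cayley.pow n
  rw [one_pow] at ht
  have h := integral_of_hasDerivAt_of_tendsto hd (hi.const_mul _)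
    (ht.mono_left atBot_le_cocompact) (ht.mono_left atTop_le_cocompact)
  rw [integral_const_mul, sub_self, mul_eq_zero] at h
  refine h.resolve_left ?_
  have : (n : ℂ) ≠ 0 := by exact_mod_cast (by omega : n ≠ 0)
  simp [this]

/-! ### Multipliers of functions with one-sided spectrum -/

/-- Exhibits the Cayley transform as a superposition of exponentials of nonnegative frequency only.
-/
theorem cayley_eq_integral (l : ℝ) :
    cayley l = 1 - 2 * ∫ u in Set.Ioi (0 : ℝ), (Real.exp (-u) : ℂ) * expFun u l := by
  have h : ∀ u : ℝ, (Real.exp (-u) : ℂ) * expFun u l = exp ((I * l - 1) * u) := fun u => by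
    rw [expFun, ofReal_exp, ← Complex.exp_add]; congr 1; push_cast; ring
  simp only [h]
  rw [integral_exp_mul_complex_Ioi (by simp), cayley_eq]
  have h1 := ofReal_add_I_ne_zero l
  have h2 : I * (l : ℂ) - 1 = I * (l + I) := by rw [mul_add, I_mul_I]; ring
  rw [h2]
  simp only [ofReal_zero, mul_zero, Complex.exp_zero]
  field_simp
  linear_combination -2 * I_sq

/-- By `cayley_eq_integral`, multiplication by the Cayley transform only raises the frequency from
`s` to `s + u` with `u ≥ 0`, where the integrals of `F` still vanish. -/
theorem integral_mul_cayley {F : ℝ → ℂ} (hF : Integrable F)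
    (h : ∀ s > 0, ∫ l, F l * expFun s l = 0) :
    ∀ s > 0, ∫ l, F l * cayley l * expFun s l = 0 := by
  intro s hs
  have he : Integrable (fun u : ℝ => (Real.exp (-u) : ℂ)) (volume.restrict (Set.Ioi 0)) :=
    (integrableOn_exp_neg_Ioi 0).ofReal
  have hp : Integrable (fun q : ℝ × ℝ => F q.1 * expFun s q.1 *
      ((Real.exp (-q.2) : ℂ) * expFun q.2 q.1)) (volume.prod (volume.restrict (Set.Ioi 0))) := by
    refine (((integrable_mul_expFun hF s).mul_prod he).mul_bdd (c := 1)
      (g := fun q : ℝ × ℝ => expFun q.2 q.1) ?_ (by simp)).congr (.of_forall fun q => ?_)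
    · exact (continuous_uncurry_expFun.comp continuous_swap).aestronglyMeasurable
    · simp only; ring
  have h0 : ∫ l, ∫ u in Set.Ioi (0 : ℝ), F l * expFun s l *
      ((Real.exp (-u) : ℂ) * expFun u l) = 0 := by
    rw [integral_integral_swap hp]
    refine setIntegral_eq_zero_of_forall_eq_zero fun u hu => ?_
    have e : ∀ l, F l * expFun s l * ((Real.exp (-u) : ℂ) * expFun u l) =
        (Real.exp (-u) : ℂ) * (F l * expFun (s + u) l) := fun l => by rw [expFun_add]; ring
    simp only [e]
    rw [integral_const_mul, h _ (add_pos hs hu), mul_zero]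
  have e : ∀ l, F l * cayley l * expFun s l = F l * expFun s l -
      2 * ∫ u in Set.Ioi (0 : ℝ), F l * expFun s l * ((Real.exp (-u) : ℂ) * expFun u l) :=
    fun l => by
      rw [integral_const_mul, cayley_eq_integral]; ring
  simp only [e]
  rw [integral_sub (integrable_mul_expFun hF s) (hp.integral_prod_left.const_mul 2), h s hs,
    integral_const_mul, h0]
  simp

theorem integral_mul_cayley_pow {F : ℝ → ℂ} (hF : Integrable F)
    (h : ∀ s > 0, ∫ l, F l * expFun s l = 0) (n : ℕ) :
    ∀ s > 0, ∫ l, F l * cayley l ^ n * expFun s l = 0 := by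
  have hi : ∀ n : ℕ, Integrable fun l => F l * cayley l ^ n := fun n =>
    hF.mul_bdd (c := 1) (continuous_cayley.pow n).aestronglyMeasurable (by simp)
  induction n with
  | zero => simpa using h
  | succ n ih =>
    have := integral_mul_cayley (hi n) ih
    simpa only [pow_succ, mul_assoc] using this

/-- The extremal element of a sequence `x 0, x 1, …` in a Hilbert space: the component of `x 0`
orthogonal to `x 1, x 2, …`. -/
theorem exists_extremal {E : Type*} [NormedAddCommGroup E] [InnerProductSpace ℂ E] [CompleteSpace E]
    (x : ℕ → E) : ∃ y : E, (∀ n, 1 ≤ n → inner ℂ (x n) y = 0) ∧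
      ∀ k, (∀ n, 1 ≤ n → inner ℂ (x n) k = 0) → inner ℂ y k = inner ℂ (x 0) k := by
  let V : Submodule ℂ E := (Submodule.span ℂ (x '' {n | 1 ≤ n})).topologicalClosure
  have : CompleteSpace V := (Submodule.isClosed_topologicalClosure _).completeSpace_coe
  have hx : ∀ n, 1 ≤ n → x n ∈ V := fun n hn =>
    Submodule.le_topologicalClosure _ (Submodule.subset_span ⟨n, hn, rfl⟩)
  refine ⟨x 0 - V.starProjection (x 0), fun n hn => ?_, fun k hk => ?_⟩
  · exact Submodule.inner_right_of_mem_orthogonal (hx n hn)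
      (V.sub_starProjection_mem_orthogonal (x 0))
  · have hV : V ≤ (Submodule.span ℂ {k})ᗮ := by
      refine Submodule.topologicalClosure_minimal _ (Submodule.span_le.2 ?_)
        (Submodule.isClosed_orthogonal _)
      rintro _ ⟨n, hn, rfl⟩
      exact Submodule.mem_orthogonal_singleton_iff_inner_left.2 (hk n hn)
    have h0 := Submodule.mem_orthogonal_singleton_iff_inner_left.1
      (hV (V.starProjection_apply_mem (x 0)))
    rw [inner_sub_left, h0, sub_zero]

/-- A function `m` that makes an integrable function `F` with one-sided spectrum square-integrable
(as `|m F|² ≤ |F| / ε`) and preserves the one-sidedness of the spectrum: the extremal function of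
Szegő's problem for the weight `1 + ε (1 + λ²) |F(λ)|`. -/
theorem exists_multiplier {F : ℝ → ℂ} (hF : Integrable F)
    (h : ∀ s > 0, ∫ l, F l * expFun s l = 0) {ε : ℝ} (hε : 0 < ε) :
    ∃ m : ℝ → ℂ, AEStronglyMeasurable m ∧
      (∀ᵐ l, ‖m l‖ ^ 2 * (1 + ε * (1 + l ^ 2) * ‖F l‖) = 1) ∧
      ∀ s > 0, ∫ l, F l * m l * expFun s l = 0 := by
  have hpi : (2 * Real.pi : ℂ) ≠ 0 := by simp [Real.pi_ne_zero]
  set κ : ℝ → ℝ := fun l => (1 + l ^ 2)⁻¹ with hκ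
  have hκ0 : ∀ l, 0 < κ l := fun l => by simp only [hκ]; positivity
  have hκi : Integrable κ := integrable_inv_one_add_sq
  -- This is `κ (1 + ε(1 + λ²)|F|)`: the Szegő weight transported from arc length on the circle to
  -- the line, and integrable.
  set q : ℝ → ℝ := fun l => κ l + ε * ‖F l‖ with hq
  have hq0 : ∀ l, 0 < q l := fun l => add_pos_of_pos_of_nonneg (hκ0 l) (by positivity)
  have hqc : ∀ l, (q l : ℂ) ≠ 0 := fun l => by exact_mod_cast (hq0 l).ne'
  have hqi : Integrable q := hκi.add (hF.norm.const_mul ε)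
  have hqn : ∀ l, 0 ≤ q l := fun l => (hq0 l).le
  have := isFiniteMeasure_specMeasure hqi
  set ν := specMeasure q with hν
  have hνac : ν ≪ volume := specMeasure_ac q
  have hmem : ∀ {u : ℝ → ℂ}, AEStronglyMeasurable u → ∀ C, (∀ l, ‖u l‖ ≤ C) → MemLp u 2 ν :=
    fun hu C hC => memLp_of_bounded (hu.mono_ac hνac) C hC
  have hz : ∀ n : ℕ, MemLp (fun l => cayley l ^ n) 2 ν := fun n =>
    hmem (continuous_cayley.pow n).aestronglyMeasurable 1 (by simp)
  obtain ⟨y, hy1, hy2⟩ := exists_extremal fun n : ℕ => classL2 ν fun l => cayley l ^ n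
  have hip : ∀ {u v : ℝ → ℂ}, MemLp u 2 ν → MemLp v 2 ν →
      inner ℂ (classL2 ν u) (classL2 ν v) =
        (1 / (2 * Real.pi) : ℂ) * ∫ l, conj (u l) * v l * q l := fun hu hv => by
    rw [inner_classL2 hu hv, hν, integral_specMeasure hqi hqn]
  have hyL := Lp.memLp y
  have hyv : ∀ n, 1 ≤ n → ∫ l, conj (cayley l ^ n) * y l * q l = 0 := fun n hn => by
    have h1 := hy1 n hn
    rw [← classL2_coe y, hip (hz n) hyL] at h1
    simpa [hpi] using h1
  have hyk : ∀ {k : ℝ → ℂ}, MemLp k 2 ν → (∀ n, 1 ≤ n → ∫ l, conj (cayley l ^ n) * k l * q l = 0) →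
      ∫ l, conj (y l) * k l * q l = ∫ l, k l * q l := fun {k} hk h1 => by
    have h2 := hy2 (classL2 ν k) fun n hn => by rw [hip (hz n) hk, h1 n hn, mul_zero]
    rw [← classL2_coe y, hip hyL hk, hip (hz 0) hk] at h2
    have h3 := mul_left_cancel₀ (by simp) h2
    simpa using h3
  -- `|y|² q` is a multiple of `κ`
  have hsq : ∀ n : ℕ, 1 ≤ n → ∫ l, cayley l ^ n * ((‖y l‖ ^ 2 * q l : ℝ) : ℂ) = 0 := by
    intro n hn
    -- The function `k = z̄^n y` is orthogonal to all `z^j` with `j ≥ 1`, because `y` is orthogonal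
    -- to `z^(n+j)`. Hence `⟨y, k⟩ = ⟨1, k⟩ = ⟨z^n, y⟩ = 0`, which is the vanishing of a Fourier
    -- coefficient of `|y|² q`.
    have hk : MemLp (fun l => conj (cayley l ^ n) * y l) 2 ν := by
      refine hyL.of_le ((Complex.continuous_conj.comp
        (continuous_cayley.pow n)).aestronglyMeasurable.mul hyL.1) (.of_forall fun l => ?_)
      simp
    have h1 := hyk hk fun j hj => by
      simp only [← mul_assoc, ← map_mul, ← pow_add]
      exact hyv _ (by omega)
    rw [hyv n hn] at h1
    have h2 := congrArg conj h1
    rw [← integral_conj, map_zero] at h2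
    rw [← h2]
    refine integral_congr_ae (.of_forall fun l => ?_)
    have h3 : ((‖y l‖ ^ 2 : ℝ) : ℂ) = conj (y l) * y l := by
      rw [← Complex.normSq_eq_conj_mul_self, Complex.normSq_eq_norm_sq]
    simp only [ofReal_mul, h3, map_mul, conj_conj, conj_ofReal]
    ring
  have hyq : Integrable fun l => ‖y l‖ ^ 2 * q l := by
    have h1 := (integrable_specMeasure_iff hqi hqn _).1 (hyL.integrable_norm_pow (by norm_num))
    simpa [mul_comm] using h1
  have hyq0 : ∀ l, 0 ≤ ‖y l‖ ^ 2 * q l := fun l => mul_nonneg (by positivity) (hqn l)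
  -- Matches the zeroth moments, since `κ` has integral `π`.
  set c : ℝ := (∫ l, ‖y l‖ ^ 2 * q l) / Real.pi with hc
  have hc0 : 0 ≤ c := div_nonneg (integral_nonneg hyq0) Real.pi_pos.le
  have hmod : (fun l => ‖y l‖ ^ 2 * q l) =ᵐ[volume] fun l => c * κ l := by
    refine ae_eq_of_integral_cayley hyq hyq0 (hκi.const_mul c)
      (fun l => mul_nonneg hc0 (hκ0 l).le) fun n => ?_
    rcases Nat.eq_zero_or_pos n with rfl | hn
    · simp only [pow_zero, one_mul]
      rw [integral_complex_ofReal, integral_complex_ofReal, integral_const_mul,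
        integral_univ_inv_one_add_sq, hc, div_mul_cancel₀ _ Real.pi_ne_zero]
    · have h1 : ∀ l, cayley l ^ n * ((c * κ l : ℝ) : ℂ) = c * (cayley l ^ n * (κ l : ℂ)) :=
        fun l => by push_cast; ring
      simp only [h1]
      rw [hsq n hn, integral_const_mul, integral_cayley_pow hn, mul_zero]
  -- If `c = 0` then `y = 0`. But `κ/q` is orthogonal to every `z^n` with `n ≥ 1`, so its pairing
  -- with `y` equals its pairing with 1, which is `∫ κ = π` up to the factor `1/2π`.
  have hcne : c ≠ 0 := by
    intro h0
    have hk : MemLp (fun l => ((κ l / q l : ℝ) : ℂ)) 2 ν := by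
      refine hmem (((hκi.1.aemeasurable.div hqi.1.aemeasurable).complex_ofReal).aestronglyMeasurable)
        1 fun l => ?_
      rw [norm_real, Real.norm_of_nonneg (div_nonneg (hκ0 l).le (hqn l))]
      exact (div_le_one (hq0 l)).2 (le_add_of_nonneg_right (by positivity))
    have hkq : ∀ l, ((κ l / q l : ℝ) : ℂ) * q l = κ l := fun l => by
      push_cast; exact div_mul_cancel₀ _ (hqc l)
    have h1 := hyk hk fun n hn => by
      have h2 := congrArg conj (integral_cayley_pow hn)
      rw [← integral_conj, map_zero] at h2
      simpa only [mul_assoc, hkq, map_mul, conj_ofReal] using h2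
    simp only [mul_assoc, hkq] at h1
    rw [integral_complex_ofReal, integral_univ_inv_one_add_sq] at h1
    have h3 : ∫ l, conj (y l) * (κ l : ℂ) = 0 := by
      refine integral_eq_zero_of_ae ?_
      filter_upwards [hmod] with l hl
      rw [h0, zero_mul, mul_eq_zero] at hl
      rcases hl with hl | hl
      · have : y l = 0 := by simpa using hl
        simp [this]
      · exact absurd hl (hq0 l).ne'
    rw [h3] at h1
    exact Real.pi_ne_zero (by exact_mod_cast h1.symm)
  have hcpos : 0 < c := lt_of_le_of_ne hc0 hcne.symm
  refine ⟨fun l => ((Real.sqrt c)⁻¹ : ℝ) * y l, ?_, ?_, fun s hs => ?_⟩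
  · exact (Lp.stronglyMeasurable y).aestronglyMeasurable.const_mul _
  · filter_upwards [hmod] with l hl
    have h1 : ‖((Real.sqrt c)⁻¹ : ℝ) * y l‖ ^ 2 = c⁻¹ * ‖y l‖ ^ 2 := by
      rw [norm_mul, mul_pow, norm_real, Real.norm_of_nonneg (by positivity), inv_pow,
        Real.sq_sqrt hc0]
    have h2 : 1 + ε * (1 + l ^ 2) * ‖F l‖ = q l / κ l := by
      have := (hκ0 l).ne'
      have h3 : (1 + l ^ 2) = (κ l)⁻¹ := by simp [hκ]
      rw [h3, hq]; field_simp
    have h4 := (hκ0 l).ne'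
    rw [h1, h2]
    have : c⁻¹ * ‖y l‖ ^ 2 * (q l / κ l) = c⁻¹ * (‖y l‖ ^ 2 * q l) / κ l := by ring
    rw [this, hl]
    field_simp
  -- With `k` the conjugate of `F e^{isλ}/q`, one-sidedness of `F` makes `k` orthogonal to `z^n` for
  -- `n ≥ 1`, so `⟨y, k⟩ = ⟨1, k⟩ = 0`. Conjugating gives the vanishing integral for `F m`. The
  -- bound `ε⁻¹` comes from `q ≥ ε|F|`.
  · have hk : MemLp (fun l => conj (F l * expFun s l / (q l : ℂ))) 2 ν := by
      refine hmem ?_ (ε⁻¹) fun l => ?_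
      · exact Complex.continuous_conj.comp_aestronglyMeasurable
          ((hF.1.mul (continuous_expFun s).aestronglyMeasurable).div₀
            (hqi.1.aemeasurable.complex_ofReal.aestronglyMeasurable))
      · rw [RCLike.norm_conj, norm_div, norm_mul, norm_expFun, mul_one, norm_real,
          Real.norm_of_nonneg (hqn l), div_le_iff₀ (hq0 l)]
        simp only [hq]
        rw [mul_add, ← mul_assoc, inv_mul_cancel₀ hε.ne', one_mul]
        exact le_add_of_nonneg_left (by have := hκ0 l; positivity)
    have hkq : ∀ l, conj (F l * expFun s l / (q l : ℂ)) * q l = conj (F l * expFun s l) := fun l => by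
      rw [map_div₀, conj_ofReal]; exact div_mul_cancel₀ _ (hqc l)
    have h1 := hyk hk fun n hn => by
      have h2 := congrArg conj (integral_mul_cayley_pow hF h n s hs)
      rw [← integral_conj, map_zero] at h2
      rw [← h2]
      refine integral_congr_ae (.of_forall fun l => ?_)
      simp only
      rw [mul_assoc, hkq, ← map_mul]
      congr 1; ring
    have h2 : ∫ l, conj (F l * expFun s l) = 0 := by rw [integral_conj, h s hs, map_zero]
    simp only [mul_assoc (conj _), hkq] at h1
    rw [h2] at h1
    have h3 := congrArg conj h1
    rw [← integral_conj, map_zero] at h3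
    have e : ∀ l, F l * (((Real.sqrt c)⁻¹ : ℝ) * y l) * expFun s l =
        ((Real.sqrt c)⁻¹ : ℝ) * conj (conj (y l) * conj (F l * expFun s l)) := fun l => by
      simp only [map_mul, conj_conj]; ring
    simp only [e]
    rw [integral_const_mul, h3, mul_zero]

/-! ### Dilations of the line, for the passage between frequencies `w` and `λ = 2πw` -/

theorem memLp_comp_mul {u : ℝ → ℂ} (hu : MemLp u 2) {c : ℝ} (hc : c ≠ 0) :
    MemLp (fun l => u (c * l)) 2 := by
  have h : MemLp u 2 (Measure.map (c * ·) volume) := by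
    rw [Real.map_volume_mul_left hc]
    exact hu.smul_measure ENNReal.ofReal_ne_top
  exact h.comp_of_map (by fun_prop)

theorem ae_comp_mul {p : ℝ → Prop} (hp : ∀ᵐ l, p l) {c : ℝ} (hc : c ≠ 0) : ∀ᵐ l, p (c * l) := by
  refine Measure.QuasiMeasurePreserving.ae (μb := volume) ⟨by fun_prop, ?_⟩ hp
  rw [Real.map_volume_mul_left hc]
  exact Measure.smul_absolutelyContinuous

theorem two_pi_ne_zero : (2 * Real.pi : ℝ) ≠ 0 := by positivity

namespace Gaps

variable (G : Gaps)

/-! ### Plancherel transforms in `L₂(T)` -/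

theorem compl_T : G.Tᶜ = G.obs := by
  ext t; simp [T, obs, and_comm]

theorem isOpen_obs : IsOpen G.obs := by
  refine isOpen_Iio.sdiff (Set.Finite.isClosed_biUnion ?_ fun _ _ => isClosed_Icc)
  exact (Finset.Icc 1 G.s).finite_toSet

theorem coeFn_extend (x : G.L2T) : G.extend x =ᵐ[volume] G.T.indicator x :=
  MemLp.coeFn_toLp _

theorem memLp_fourierPlus (x : G.L2T) : MemLp (G.fourierPlus x) 2 := by
  have h := memLp_comp_mul (Lp.memLp (𝓕⁻ (G.extend x))) (inv_ne_zero two_pi_ne_zero)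
  simp only [← div_eq_inv_mul] at h
  exact h

theorem memLp_fourierMinus (x : G.L2T) : MemLp (G.fourierMinus x) 2 := by
  have h := memLp_comp_mul (Lp.memLp (𝓕 (G.extend x))) (inv_ne_zero two_pi_ne_zero)
  simp only [← div_eq_inv_mul] at h
  exact h

theorem inner_restrict (y : G.L2T) (z : Lp ℂ 2 (volume : Measure ℝ)) :
    inner ℂ y (LpToLpRestrictCLM ℝ ℂ ℂ volume 2 G.T z) = inner ℂ (G.extend y) z := by
  rw [L2.inner_def, L2.inner_def]
  have h1 : ∫ t in G.T, inner ℂ (y t) (LpToLpRestrictCLM ℝ ℂ ℂ volume 2 G.T z t) =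
      ∫ t in G.T, inner ℂ (y t) (z t) := by
    refine integral_congr_ae ?_
    filter_upwards [LpToLpRestrictCLM_coeFn ℂ G.T z] with t ht
    rw [ht]
  rw [h1, ← integral_indicator G.measurableSet_T]
  refine integral_congr_ae ?_
  filter_upwards [G.coeFn_extend y] with t ht
  rw [ht]
  by_cases hT : t ∈ G.T <;> simp [hT]

/-- Parseval's identity. -/
theorem inner_synth (y : G.L2T) {φ : ℝ → ℂ} (hφ : MemLp φ 2) :
    inner ℂ y (G.synth φ) = (1 / (2 * Real.pi) : ℂ) * ∫ l, conj (G.fourierPlus y l) * φ l := by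
  have hΦ := memLp_comp_mul hφ two_pi_ne_zero
  rw [synth, inner_restrict]
  have h1 := Lp.inner_fourier_eq (𝓕⁻ (G.extend y)) (classL2 volume fun w => φ (2 * Real.pi * w))
  rw [FourierTransform.fourier_fourierInv_eq] at h1
  rw [h1]
  have h2 := inner_classL2 (Lp.memLp (𝓕⁻ (G.extend y))) hΦ
  rw [classL2_coe] at h2
  rw [h2]
  have h3 := Measure.integral_comp_mul_left (fun l => conj (G.fourierPlus y l) * φ l) (2 * Real.pi)
  have e : ∀ w : ℝ, G.fourierPlus y (2 * Real.pi * w) = 𝓕⁻ (G.extend y) w := fun w => by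
    rw [fourierPlus, mul_div_cancel_left₀ _ two_pi_ne_zero]
  simp only [e] at h3
  rw [h3, abs_of_pos (by positivity), real_smul]
  push_cast; simp

/-- The hypothesis says that the inverse transform of `φ` vanishes off `T`, so restricting it to `T`
and extending by zero loses nothing. -/
theorem fourierPlus_synth {φ : ℝ → ℂ} (hφ : Integrable φ) (hφ2 : MemLp φ 2)
    (h : ∀ t ∈ G.obs, ∫ l, φ l * expFun (-t) l = 0) :
    G.fourierPlus (G.synth φ) =ᵐ[volume] φ := by
  have hΦ2 := memLp_comp_mul hφ2 two_pi_ne_zero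
  have hΦ : Integrable fun w => φ (2 * Real.pi * w) := hφ.comp_mul_left' two_pi_ne_zero
  set z : Lp ℂ 2 (volume : Measure ℝ) := 𝓕 (classL2 volume fun w : ℝ => φ (2 * Real.pi * w)) with hz
  have hz0 : ∀ᵐ t, t ∉ G.T → z t = 0 := by
    have h1 := coeFn_fourier_toLp hΦ hΦ2
    rw [← classL2_eq hΦ2, ← hz] at h1
    filter_upwards [h1] with t ht hT
    rw [ht, fourier_eq_integral_expFun]
    have h2 := Measure.integral_comp_mul_left (fun l => φ l * expFun (-t) l) (2 * Real.pi)
    rw [h t (by rw [← compl_T]; exact hT), smul_zero] at h2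
    rw [← h2]
    congr 1; ext v; simp only [expFun]; congr 2; push_cast; ring
  have hext : G.extend (G.synth φ) = z := by
    refine Lp.ext ((G.coeFn_extend _).trans ?_)
    have h1 := (ae_restrict_iff' G.measurableSet_T).1 (LpToLpRestrictCLM_coeFn ℂ G.T z)
    filter_upwards [h1, hz0] with t h1 h2
    by_cases hT : t ∈ G.T
    · rw [Set.indicator_of_mem hT]; exact h1 hT
    · rw [Set.indicator_of_notMem hT, h2 hT]
  have h1 : 𝓕⁻ (G.extend (G.synth φ)) = classL2 volume fun w : ℝ => φ (2 * Real.pi * w) := by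
    rw [hext, hz, FourierTransform.fourierInv_fourier_eq]
  have h2 := ae_comp_mul (coeFn_classL2 hΦ2) (inv_ne_zero two_pi_ne_zero)
  filter_upwards [h2] with l hl
  rw [fourierPlus, h1, div_eq_inv_mul, hl, ← mul_assoc, mul_inv_cancel₀ two_pi_ne_zero, one_mul]

/-- Integrability makes the inverse transform continuous, and a continuous function that is zero
almost everywhere on an open set is zero at each of its points. Pointwise vanishing is needed
because each observation is a separate constraint. -/
theorem integral_fourierPlus_mul_expFun {x : G.L2T} (hx : Integrable (G.fourierPlus x)) :
    ∀ t ∈ G.obs, ∫ l, G.fourierPlus x l * expFun (-t) l = 0 := by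
  set u : Lp ℂ 2 (volume : Measure ℝ) := 𝓕⁻ (G.extend x) with hu
  have e : ∀ w : ℝ, G.fourierPlus x (2 * Real.pi * w) = u w := fun w => by
    rw [fourierPlus, mul_div_cancel_left₀ _ two_pi_ne_zero]
  have hui : Integrable u := by
    have := hx.comp_mul_left' two_pi_ne_zero
    simpa only [e] using! this
  have h1 := coeFn_fourier_toLp hui (Lp.memLp u)
  rw [Lp.toLp_coeFn, hu, FourierTransform.fourier_fourierInv_eq, ← hu] at h1
  have h2 : 𝓕 (u : ℝ → ℂ) =ᵐ[volume.restrict G.obs] 0 := by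
    refine (ae_restrict_iff' G.isOpen_obs.measurableSet).2 ?_
    filter_upwards [h1, G.coeFn_extend x] with t ht ht2 hobs
    rw [← ht, ht2, Set.indicator_of_notMem]; rfl
    rw [← compl_T] at hobs; exact hobs
  have h3 := Measure.eqOn_open_of_ae_eq h2 G.isOpen_obs (continuous_fourier hui).continuousOn
    continuousOn_const
  intro t ht
  have h4 := h3 ht
  rw [fourier_eq_integral_expFun] at h4
  have h5 := Measure.integral_comp_mul_left (fun l => G.fourierPlus x l * expFun (-t) l)
    (2 * Real.pi)
  have h6 : ∫ w, G.fourierPlus x (2 * Real.pi * w) * expFun (-t) (2 * Real.pi * w) = 0 := by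
    refine Eq.trans ?_ h4
    congr 1; ext v; rw [e]; simp only [expFun]; congr 2; push_cast; ring
  rw [h6, eq_comm, smul_eq_zero] at h5
  refine h5.resolve_left ?_
  simp [Real.pi_ne_zero]

theorem R_subset_T : G.R ⊆ G.T := fun _ ht => Set.mem_union_right _ ht.1

theorem coeFn_bold {a : ℝ → ℂ} (ha : MemLp a 2 (volume.restrict G.R)) :
    G.bold a ha =ᵐ[volume.restrict G.T] G.R.indicator a := MemLp.coeFn_toLp _

theorem fourierMinus_bold {a : ℝ → ℂ} (ha1 : IntegrableOn a G.R)
    (ha : MemLp a 2 (volume.restrict G.R)) :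
    G.fourierMinus (G.bold a ha) =ᵐ[volume] G.symbolA a := by
  have hi : Integrable (G.R.indicator a) := (integrable_indicator_iff G.measurableSet_R).2 ha1
  have hm : MemLp (G.R.indicator a) 2 := (memLp_indicator_iff_restrict G.measurableSet_R).2 ha
  have hext : G.extend (G.bold a ha) = hm.toLp _ := by
    refine Lp.ext ((G.coeFn_extend _).trans (Filter.EventuallyEq.trans ?_ hm.coeFn_toLp.symm))
    filter_upwards [(ae_restrict_iff' G.measurableSet_T).1 (G.coeFn_bold ha)] with t ht
    by_cases hT : t ∈ G.T
    · rw [Set.indicator_of_mem hT, ht hT]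
    · rw [Set.indicator_of_notMem hT, Set.indicator_of_notMem fun h => hT (G.R_subset_T h)]
  have h1 := ae_comp_mul (coeFn_fourier_toLp hi hm) (inv_ne_zero two_pi_ne_zero)
  filter_upwards [h1] with l hl
  rw [fourierMinus, hext, div_eq_inv_mul, hl, fourier_eq_integral_expFun, symbolA,
    ← integral_indicator G.measurableSet_R, ← mul_assoc, mul_inv_cancel₀ two_pi_ne_zero, one_mul]
  congr 1; ext t
  by_cases hR : t ∈ G.R
  · simp only [Set.indicator_of_mem hR, expFun]; congr 2; push_cast; ring
  · simp [hR]

/-! ### The operator `B` -/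

variable {G} {f g : ℝ → ℝ}

theorem nontrivial_L2T : Nontrivial G.L2T := by
  have hm : MeasurableSet (Set.Icc (0 : ℝ) 1) := measurableSet_Icc
  have hsub : Set.Icc (0 : ℝ) 1 ⊆ G.T := fun t ht => Set.mem_union_right _ ht.1
  have hv : (volume.restrict G.T) (Set.Icc (0 : ℝ) 1) = 1 := by
    rw [Measure.restrict_apply hm, Set.inter_eq_left.2 hsub]; simp
  refine ⟨indicatorConstLp 2 hm (by rw [hv]; simp) (1 : ℂ), 0, fun h => ?_⟩
  have := congrArg norm h
  rw [norm_indicatorConstLp (by norm_num) (by norm_num), measureReal_def, hv] at this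
  simp at this

/-- For a graph that is not single-valued `toLinearPMap` defaults to the zero map, which cannot be
onto the nontrivial space `L₂(T)`. So `InvertibleB` already contains single-valuedness. -/
theorem graph_functional (hB : G.InvertibleB f g) :
    ∀ p ∈ G.graphB f g, p.1 = 0 → p.2 = 0 := by
  by_contra hg
  have h0 : (G.opB f g).toFun = 0 := by
    unfold opB Submodule.toLinearPMap
    exact dif_neg hg
  obtain ⟨x, hx⟩ := (@exists_ne G.L2T nontrivial_L2T 0)
  obtain ⟨d, hd⟩ := hB.2 x
  rw [h0] at hd
  exact hx hd.symm

theorem invB_mem_graph (hB : G.InvertibleB f g) (r : G.L2T) :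
    (G.invB hB r, r) ∈ G.graphB f g := by
  have h := Submodule.mem_graph_toLinearPMap (graph_functional hB)
    ((LinearEquiv.ofBijective (G.opB f g).toFun hB).symm r)
  have h2 := (LinearEquiv.ofBijective (G.opB f g).toFun hB).apply_symm_apply r
  have h3 : (G.graphB f g).toLinearPMap ((LinearEquiv.ofBijective (G.opB f g).toFun hB).symm r) = r :=
    h2
  rw [h3] at h
  exact h

theorem invB_mem_formDomain (hB : G.InvertibleB f g) (r : G.L2T) :
    G.invB hB r ∈ G.formDomain f g := (invB_mem_graph hB r).1

theorem form_invB (hB : G.InvertibleB f g) (r : G.L2T) {y : G.L2T} (hy : y ∈ G.formDomain f g) :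
    G.form f g y (G.invB hB r) = inner ℂ y r := (invB_mem_graph hB r).2 y hy

theorem form_eq_inner {x y : G.L2T} (hx : x ∈ G.formDomain f g) (hy : y ∈ G.formDomain f g) :
    G.form f g y x = (1 / (2 * Real.pi) : ℂ) * inner ℂ (classL2 (invMeasure f g) (G.fourierPlus y))
      (classL2 (invMeasure f g) (G.fourierPlus x)) := by
  rw [inner_classL2 hy hx, form]

theorem conj_form {x y : G.L2T} (hx : x ∈ G.formDomain f g) (hy : y ∈ G.formDomain f g) :
    conj (G.form f g x y) = G.form f g y x := by
  rw [form_eq_inner hx hy, form_eq_inner hy hx, map_mul, inner_conj_symm]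
  congr 1
  rw [show (1 / (2 * Real.pi) : ℂ) = ((1 / (2 * Real.pi) : ℝ) : ℂ) by push_cast; rfl, conj_ofReal]

/-- The form of an invertible `B` is bounded below. -/
theorem exists_norm_sq_le (hB : G.InvertibleB f g) : ∃ k : ℝ, 0 ≤ k ∧ ∀ y ∈ G.formDomain f g,
    ‖y‖ ^ 2 ≤ k * ‖classL2 (invMeasure f g) (G.fourierPlus y)‖ ^ 2 := by
  let K : G.L2T →ₗ[ℂ] G.L2T := (G.opB f g).domain.subtype ∘ₗ
    (LinearEquiv.ofBijective (G.opB f g).toFun hB).symm.toLinearMap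
  have hK : ∀ r, K r = G.invB hB r := fun r => rfl
  have hsym : K.IsSymmetric := fun r r' => by
    rw [hK, hK, ← form_invB hB r' (invB_mem_formDomain hB r), ← inner_conj_symm,
      ← form_invB hB r (invB_mem_formDomain hB r'),
      conj_form (invB_mem_formDomain hB r') (invB_mem_formDomain hB r)]
  -- Hellinger–Toeplitz: a symmetric operator defined on the whole space is bounded.
  let K' : G.L2T →L[ℂ] G.L2T := ⟨K, hsym.continuous⟩
  refine ⟨(2 * Real.pi)⁻¹ * ‖K'‖, by positivity, fun y hy => ?_⟩
  have hKy := invB_mem_formDomain hB y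
  set Y := classL2 (invMeasure f g) (G.fourierPlus y)
  set Z := classL2 (invMeasure f g) (G.fourierPlus (G.invB hB y))
  -- Here `⟨y, y⟩` is the form at `y` and `B⁻¹y`; Cauchy–Schwarz for the form applies. The form at
  -- `B⁻¹y` is in turn `⟨B⁻¹y, y⟩`, which the operator norm bounds, and one factor `‖y‖²` cancels at
  -- the end.
  have h1 : ‖y‖ ^ 2 ≤ (2 * Real.pi)⁻¹ * (‖Y‖ * ‖Z‖) := by
    have h := form_invB hB y hy
    rw [form_eq_inner hKy hy, inner_self_eq_norm_sq_to_K] at h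
    have h' := congrArg norm h
    rw [norm_mul, norm_pow] at h'
    simp only [one_div, norm_inv, norm_mul, norm_real, RCLike.norm_ofNat, Real.norm_eq_abs,
      abs_of_pos Real.pi_pos, RCLike.norm_ofReal, abs_norm] at h'
    rw [← h']
    gcongr
    exact norm_inner_le_norm _ _
  have h2 : (2 * Real.pi)⁻¹ * ‖Z‖ ^ 2 ≤ ‖K'‖ * ‖y‖ ^ 2 := by
    have h := form_invB hB y hKy
    rw [form_eq_inner hKy hKy, inner_self_eq_norm_sq_to_K] at h
    have h' := congrArg norm h
    rw [norm_mul, norm_pow] at h'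
    simp only [one_div, norm_inv, norm_mul, norm_real, RCLike.norm_ofNat, Real.norm_eq_abs,
      abs_of_pos Real.pi_pos, RCLike.norm_ofReal, abs_norm] at h'
    rw [h', sq, ← mul_assoc]
    refine (norm_inner_le_norm _ _).trans ?_
    gcongr
    exact K'.le_opNorm y
  rcases (sq_nonneg ‖y‖).eq_or_lt with h0 | h0
  · rw [← h0]; positivity
  · have h3 : (‖y‖ ^ 2) ^ 2 ≤ ((2 * Real.pi)⁻¹ * ‖K'‖ * ‖Y‖ ^ 2) * ‖y‖ ^ 2 := by
      calc (‖y‖ ^ 2) ^ 2 ≤ ((2 * Real.pi)⁻¹ * (‖Y‖ * ‖Z‖)) ^ 2 := by gcongr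
        _ = ((2 * Real.pi)⁻¹ * ‖Y‖ ^ 2) * ((2 * Real.pi)⁻¹ * ‖Z‖ ^ 2) := by ring
        _ ≤ ((2 * Real.pi)⁻¹ * ‖Y‖ ^ 2) * (‖K'‖ * ‖y‖ ^ 2) := by gcongr
        _ = _ := by ring
    rw [sq (‖y‖ ^ 2)] at h3
    exact le_of_mul_le_mul_right h3 h0

end Gaps

/-! ### The densities -/

section densities

variable {f g : ℝ → ℝ}

/-- An entire function that is nonzero somewhere on the line has a null set of real zeros. Off it, a
zero of `f + g` makes the integrand infinite, which can happen only on a null set. -/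
theorem Minimality.ae_pos (h : Minimality f g) (hf : Integrable f) (hg : Integrable g) :
    ∀ᵐ l, 0 < f l + g l := by
  obtain ⟨α, γ, -, hγ, -, -, ⟨l₀, hl₀⟩, hfin⟩ := h
  have han : AnalyticOnNhd ℝ (fun l : ℝ => γ l) Set.univ := fun l _ =>
    AnalyticAt.fun_comp (f := fun l : ℝ => (l : ℂ)) ((hγ.analyticAt _).restrictScalars)
      (Complex.ofRealCLM.analyticAt l)
  have hne : ∀ᵐ l : ℝ, γ l ≠ 0 := by
    have h1 := han.preimage_zero_mem_codiscrete hl₀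
    have h2 := ae_restrict_le_codiscreteWithin (μ := volume) MeasurableSet.univ h1
    rw [Measure.restrict_univ] at h2
    exact h2
  have hm : AEMeasurable fun l : ℝ => ‖γ l‖ₑ ^ 2 / ENNReal.ofReal (f l + g l) :=
    ((hγ.continuous.comp continuous_ofReal).measurable.enorm.pow_const 2).aemeasurable.div
      (hf.add hg).aestronglyMeasurable.aemeasurable.ennreal_ofReal
  filter_upwards [hne, ae_lt_top' hm hfin.ne] with l h1 h2
  by_contra h3
  rw [ENNReal.ofReal_of_nonpos (not_lt.1 h3), ENNReal.div_zero (by simpa using h1)] at h2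
  exact lt_irrefl _ h2

theorem aemeasurable_inv_ofReal (hf : Integrable f) (hg : Integrable g) :
    AEMeasurable fun l => (ENNReal.ofReal (f l + g l))⁻¹ :=
  (hf.add hg).aestronglyMeasurable.aemeasurable.ennreal_ofReal.inv

theorem ae_inv_ofReal_lt_top (hp : ∀ᵐ l, 0 < f l + g l) :
    ∀ᵐ l, (ENNReal.ofReal (f l + g l))⁻¹ < ∞ := by
  filter_upwards [hp] with l hl
  simpa using hl

theorem integral_invMeasure {E : Type*} [NormedAddCommGroup E] [NormedSpace ℝ E]
    (hf : Integrable f) (hg : Integrable g) (hp : ∀ᵐ l, 0 < f l + g l) (u : ℝ → E) :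
    ∫ l, u l ∂(Gaps.invMeasure f g) = ∫ l, (f l + g l)⁻¹ • u l := by
  unfold Gaps.invMeasure
  rw [integral_withDensity_eq_integral_toReal_smul₀ (aemeasurable_inv_ofReal hf hg)
    (ae_inv_ofReal_lt_top hp)]
  refine integral_congr_ae ?_
  filter_upwards [hp] with l hl
  rw [ENNReal.toReal_inv, ENNReal.toReal_ofReal hl.le]

theorem memLp_invMeasure_iff (hf : Integrable f) (hg : Integrable g) (hp : ∀ᵐ l, 0 < f l + g l)
    {u : ℝ → ℂ} (hu : AEStronglyMeasurable u) :
    MemLp u 2 (Gaps.invMeasure f g) ↔ Integrable fun l => (f l + g l)⁻¹ * ‖u l‖ ^ 2 := by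
  rw [memLp_two_iff_integrable_sq_norm (hu.mono_ac (Gaps.ac f g))]
  unfold Gaps.invMeasure
  rw [integrable_withDensity_iff_integrable_smul₀' (aemeasurable_inv_ofReal hf hg)
    (ae_inv_ofReal_lt_top hp)]
  refine integrable_congr ?_
  filter_upwards [hp] with l hl
  rw [ENNReal.toReal_inv, ENNReal.toReal_ofReal hl.le, smul_eq_mul]

theorem memLp_specMeasure_iff (hf : Integrable f) (hf0 : ∀ l, 0 ≤ f l)
    {u : ℝ → ℂ} (hu : AEStronglyMeasurable u) :
    MemLp u 2 (specMeasure f) ↔ Integrable fun l => f l * ‖u l‖ ^ 2 := by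
  rw [memLp_two_iff_integrable_sq_norm (hu.mono_ac (specMeasure_ac f)),
    integrable_specMeasure_iff hf hf0]
  rfl

/-- Pointwise `|u| ≤ |u|²/(f + g) + (f + g)`, by completing the square. -/
theorem integrable_of_memLp_invMeasure (hf : Integrable f) (hg : Integrable g)
    (hp : ∀ᵐ l, 0 < f l + g l) {u : ℝ → ℂ} (hu : AEStronglyMeasurable u)
    (hu2 : MemLp u 2 (Gaps.invMeasure f g)) : Integrable u := by
  refine (((memLp_invMeasure_iff hf hg hp hu).1 hu2).add (hf.add hg)).mono' hu ?_
  filter_upwards [hp] with l hl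
  simp only [Pi.add_apply]
  have h1 : (f l + g l)⁻¹ * ‖u l‖ ^ 2 + (f l + g l) - ‖u l‖ =
      (f l + g l)⁻¹ * ((‖u l‖ - (f l + g l) / 2) ^ 2 + 3 / 4 * (f l + g l) ^ 2) := by
    field_simp; ring
  have h2 : 0 ≤ (f l + g l)⁻¹ * ((‖u l‖ - (f l + g l) / 2) ^ 2 + 3 / 4 * (f l + g l) ^ 2) := by
    positivity
  linarith

end densities

/-! ### Square-integrability of functions with spectrum in `T` -/

namespace Gaps

variable {G : Gaps} {f g : ℝ → ℝ}

theorem obs_subset_Iio : G.obs ⊆ Set.Iio 0 := Set.sdiff_subset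

theorem exists_Iio_subset_obs (G : Gaps) : ∃ L : ℝ, ∀ t < -L, t ∈ G.obs := by
  have hb : Bornology.IsBounded G.S :=
    (Bornology.isBounded_biUnion_finset _).2 fun _ _ => Metric.isBounded_Icc _ _
  obtain ⟨r, hr⟩ := hb.subset_closedBall 0
  refine ⟨max r 0, fun t ht => ⟨?_, fun hS => ?_⟩⟩
  · have := le_max_right r 0
    exact Set.mem_Iio.2 (by linarith)
  · have h1 := hr hS
    rw [mem_closedBall_zero_iff, Real.norm_eq_abs] at h1
    have := neg_le_of_abs_le h1
    have := le_max_left r 0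
    linarith

/-- The lower bound of the form of `B`, for functions with spectrum in `T`. -/
theorem exists_integral_norm_sq_le (hB : G.InvertibleB f g) (hf : Integrable f) (hg : Integrable g)
    (hp : ∀ᵐ l, 0 < f l + g l) :
    ∃ k : ℝ, 0 ≤ k ∧ ∀ ψ : ℝ → ℂ, Integrable ψ → MemLp ψ 2 → MemLp ψ 2 (invMeasure f g) →
      (∀ t ∈ G.obs, ∫ l, ψ l * expFun (-t) l = 0) →
      ∫ l, ‖ψ l‖ ^ 2 ≤ k * ∫ l, (f l + g l)⁻¹ * ‖ψ l‖ ^ 2 := by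
  obtain ⟨k, hk0, hk⟩ := exists_norm_sq_le hB
  refine ⟨2 * Real.pi * k, by positivity, fun ψ h1 h2 h3 h4 => ?_⟩
  have hψ := G.fourierPlus_synth h1 h2 h4
  have hψ' := (ac f g).ae_le hψ
  have hy : G.synth ψ ∈ G.formDomain f g := (memLp_congr_ae hψ').2 h3
  have h5 := hk _ hy
  rw [norm_sq_classL2 hy] at h5
  have h6 : ∫ l, ‖G.fourierPlus (G.synth ψ) l‖ ^ 2 ∂(invMeasure f g) =
      ∫ l, (f l + g l)⁻¹ * ‖ψ l‖ ^ 2 := by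
    rw [integral_invMeasure hf hg hp]
    refine integral_congr_ae ?_
    filter_upwards [hψ] with l hl
    rw [hl, smul_eq_mul]
  have h7 : ‖G.synth ψ‖ ^ 2 = (2 * Real.pi)⁻¹ * ∫ l, ‖ψ l‖ ^ 2 := by
    have h := G.inner_synth (G.synth ψ) h2
    rw [inner_self_eq_norm_sq_to_K] at h
    have e : ∫ l, conj (G.fourierPlus (G.synth ψ) l) * ψ l = ((∫ l, ‖ψ l‖ ^ 2 : ℝ) : ℂ) := by
      rw [← integral_complex_ofReal]
      refine integral_congr_ae ?_
      filter_upwards [hψ] with l hl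
      rw [hl, ← Complex.normSq_eq_conj_mul_self, Complex.normSq_eq_norm_sq]
    rw [e] at h
    have h' : ((‖G.synth ψ‖ ^ 2 : ℝ) : ℂ) = (((2 * Real.pi)⁻¹ * ∫ l, ‖ψ l‖ ^ 2 : ℝ) : ℂ) := by
      push_cast at h ⊢
      rw [← one_div]; exact h
    exact_mod_cast h'
  rw [h6, h7, inv_mul_le_iff₀ (by positivity)] at h5
  rw [mul_assoc]; exact h5

/-- For an invertible `B`, a function in `L₂(dλ / (f + g))` with spectrum in `T` is
square-integrable. -/
theorem memLp_two_of_integral_expFun (hB : G.InvertibleB f g) (hf : Integrable f)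
    (hg : Integrable g) (hp : ∀ᵐ l, 0 < f l + g l) {F : ℝ → ℂ} (hF : Integrable F)
    (hF2 : MemLp F 2 (invMeasure f g)) (h : ∀ t ∈ G.obs, ∫ l, F l * expFun (-t) l = 0) :
    MemLp F 2 := by
  obtain ⟨k, hk0, hk⟩ := exists_integral_norm_sq_le hB hf hg hp
  obtain ⟨L, hL⟩ := exists_Iio_subset_obs G
  -- The gaps lie in a bounded set, so a shift by `L` moves the spectrum of `F` into the half-line,
  -- as `exists_multiplier` requires.
  have hF1 : Integrable fun l => F l * expFun L l := integrable_mul_expFun hF L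
  have hF1s : ∀ s > 0, ∫ l, F l * expFun L l * expFun s l = 0 := fun s hs => by
    have h1 := h (-(L + s)) (hL _ (by linarith))
    simpa only [neg_neg, expFun_add, mul_assoc] using h1
  have hinv := (memLp_invMeasure_iff hf hg hp hF.1).1 hF2
  set ε : ℕ → ℝ := fun n => 1 / ((n : ℝ) + 1) with hε
  have hε0 : ∀ n, 0 < ε n := fun n => by simp only [hε]; positivity
  -- This is `|F m|²` for the multiplier `m` with parameter `ε n`; it increases to `|F|²` as `ε n →
  -- 0`.
  set v : ℕ → ℝ → ℝ := fun n l => ‖F l‖ ^ 2 / (1 + ε n * (1 + l ^ 2) * ‖F l‖) with hv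
  have hd : ∀ n l, 1 ≤ 1 + ε n * (1 + l ^ 2) * ‖F l‖ := fun n l => by
    have := hε0 n
    have : 0 ≤ ε n * (1 + l ^ 2) * ‖F l‖ := by positivity
    linarith
  have hv0 : ∀ n l, 0 ≤ v n l := fun n l =>
    div_nonneg (by positivity) (zero_le_one.trans (hd n l))
  have hvF : ∀ n l, v n l ≤ ‖F l‖ ^ 2 := fun n l => div_le_self (by positivity) (hd n l)
  have hvm : ∀ n, AEMeasurable (v n) := fun n => by
    have := hF.1.norm.aemeasurable
    have h2 : AEMeasurable fun l : ℝ => ε n * (1 + l ^ 2) := by fun_prop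
    exact (this.pow_const 2).div ((h2.mul this).const_add 1)
  have hvi : ∀ n, Integrable (v n) := fun n => by
    refine (hF.norm.const_mul (ε n)⁻¹).mono' (hvm n).aestronglyMeasurable (.of_forall fun l => ?_)
    rw [Real.norm_of_nonneg (hv0 n l)]
    have := hε0 n
    rw [hv]
    refine (div_le_iff₀ (zero_lt_one.trans_le (hd n l))).2 ?_
    have e : (ε n)⁻¹ * ‖F l‖ * (1 + ε n * (1 + l ^ 2) * ‖F l‖) - ‖F l‖ ^ 2 =
        (ε n)⁻¹ * ‖F l‖ + l ^ 2 * ‖F l‖ ^ 2 := by field_simp; ring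
    have : 0 ≤ (ε n)⁻¹ * ‖F l‖ + l ^ 2 * ‖F l‖ ^ 2 := by positivity
    linarith
  set C : ℝ := k * ∫ l, (f l + g l)⁻¹ * ‖F l‖ ^ 2 with hC
  have hbound : ∀ n, ∫ l, v n l ≤ C := fun n => by
    obtain ⟨m, hm, hm1, hm2⟩ := exists_multiplier hF1 hF1s (hε0 n)
    set ψ : ℝ → ℂ := fun l => F l * expFun L l * m l
    have hψv : ∀ᵐ l, ‖ψ l‖ ^ 2 = v n l := by
      filter_upwards [hm1] with l hl
      simp only [norm_mul, norm_expFun, mul_one] at hl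
      simp only [ψ, norm_mul, norm_expFun, mul_one, hv]
      rw [eq_div_iff (zero_lt_one.trans_le (hd n l)).ne', mul_pow, mul_assoc, hl, mul_one]
    have hψm : AEStronglyMeasurable ψ := hF1.1.mul hm
    have hψ2 : MemLp ψ 2 := by
      rw [memLp_two_iff_integrable_sq_norm hψm]
      exact (integrable_congr hψv).2 (hvi n)
    have hψn : ∀ᵐ l, ‖ψ l‖ ≤ ‖F l‖ := by
      filter_upwards [hψv] with l hl
      have := hvF n l
      rw [← hl] at this
      exact (sq_le_sq₀ (norm_nonneg _) (norm_nonneg _)).1 this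
    have hψ1 : Integrable ψ := hF.norm.mono' hψm hψn
    have hψ3 : MemLp ψ 2 (invMeasure f g) :=
      hF2.of_le (hψm.mono_ac (ac f g)) ((ac f g).ae_le hψn)
    -- The shifted product has no spectrum on the whole negative half-line, in particular none at
    -- the observation times, so the form bound applies to it.
    have h1 := hk ψ hψ1 hψ2 hψ3 fun t ht => hm2 (-t) (by
      have := obs_subset_Iio ht
      simp only [Set.mem_Iio] at this
      linarith)
    rw [integral_congr_ae hψv] at h1
    refine h1.trans (mul_le_mul_of_nonneg_left ?_ hk0)
    refine integral_mono_ae ((memLp_invMeasure_iff hf hg hp hψm).1 hψ3) hinv ?_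
    filter_upwards [hψn, hp] with l h1 h2
    gcongr
  have hlim : ∀ l, Filter.Tendsto (fun n => ENNReal.ofReal (v n l)) Filter.atTop
      (nhds (ENNReal.ofReal (‖F l‖ ^ 2))) := fun l => by
    refine ENNReal.tendsto_ofReal ?_
    have h1 : Filter.Tendsto ε Filter.atTop (nhds 0) := tendsto_one_div_add_atTop_nhds_zero_nat
    have h2 := (tendsto_const_nhds (x := ‖F l‖ ^ 2)).div
      (((h1.mul_const (1 + l ^ 2)).mul_const ‖F l‖).const_add 1) (by simp)
    simp only [zero_mul, add_zero, div_one] at h2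
    exact h2
  rw [memLp_two_iff_integrable_sq_norm hF.1]
  refine ⟨hF.1.norm.pow 2, ?_⟩
  rw [hasFiniteIntegral_iff_ofReal (.of_forall fun l => by positivity)]
  -- Fatou's lemma: the bound `C` does not depend on `n`, since `|m| ≤ 1` keeps the weighted norm
  -- below that of `F`.
  calc ∫⁻ l, ENNReal.ofReal (‖F l‖ ^ 2)
      = ∫⁻ l, Filter.liminf (fun n => ENNReal.ofReal (v n l)) Filter.atTop := by
        congr 1; ext l; rw [(hlim l).liminf_eq]
    _ ≤ Filter.liminf (fun n => ∫⁻ l, ENNReal.ofReal (v n l)) Filter.atTop :=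
        lintegral_liminf_le' fun n => (hvm n).ennreal_ofReal
    _ ≤ ENNReal.ofReal C := by
        refine Filter.liminf_le_of_frequently_le' (.of_forall fun n => ?_)
        rw [← ofReal_integral_eq_lintegral_ofReal (hvi n) (.of_forall (hv0 n))]
        exact ENNReal.ofReal_le_ofReal (hbound n)
    _ < ∞ := ENNReal.ofReal_lt_top

/-! ### The operator `Q` -/

theorem integral_mul_integral_expFun {μ : Measure ℝ} [SFinite μ] {a W : ℝ → ℂ}
    (ha : Integrable a μ) (hW : Integrable W) :
    ∫ t, a t * (∫ l, expFun (-t) l * W l) ∂μ = ∫ l, (∫ t, a t * expFun (-t) l ∂μ) * W l := by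
  simp only [← integral_const_mul, ← integral_mul_const]
  rw [integral_integral_swap]
  · refine integral_congr_ae (.of_forall fun l => integral_congr_ae (.of_forall fun t => ?_))
    simp only; ring
  · refine ((ha.mul_prod hW).mul_bdd (c := 1) (g := fun q : ℝ × ℝ => expFun (-q.1) q.2) ?_
      (by simp)).congr (.of_forall fun q => ?_)
    · exact (continuous_uncurry_expFun.comp
        ((continuous_neg.comp continuous_fst).prodMk continuous_snd)).aestronglyMeasurable
    · simp only [Function.uncurry]; ring

theorem setIntegral_bold {a : ℝ → ℂ} (ha : MemLp a 2 (volume.restrict G.R)) {Φ : ℂ → ℝ → ℂ}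
    (hΦ : ∀ t, Φ 0 t = 0) : ∫ t in G.T, Φ (G.bold a ha t) t = ∫ t in G.R, Φ (a t) t := by
  have h1 : ∫ t in G.T, Φ (G.bold a ha t) t = ∫ t in G.T, G.R.indicator (fun t => Φ (a t) t) t := by
    refine integral_congr_ae ?_
    filter_upwards [G.coeFn_bold ha] with t ht
    rw [ht]
    by_cases hR : t ∈ G.R <;> simp [hR, hΦ]
  rw [h1, setIntegral_indicator G.measurableSet_R, Set.inter_eq_right.2 G.R_subset_T]

/-- Two applications of Fubini, one for each integration against `a`, both legitimate because `a`
and the weight are integrable. -/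
theorem integral_opQ {a : ℝ → ℂ} (ha1 : IntegrableOn a G.R) (ha : MemLp a 2 (volume.restrict G.R))
    {w : ℝ → ℝ} (hw : w = fun l => f l * g l / (f l + g l)) (hwi : Integrable w) :
    ∫ t in G.T, G.opQ f g (G.bold a ha) t * conj (G.bold a ha t) =
      (1 / (2 * Real.pi) : ℂ) * ∫ l, conj (G.symbolA a l) * G.symbolA a l * w l := by
  have hA := G.continuous_symbolA ha1
  have hQ : ∀ t, G.opQ f g (G.bold a ha) t =
      (1 / (2 * Real.pi) : ℂ) * ∫ l, G.symbolA a l * (expFun t l * w l) := fun t => by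
    rw [opQ]
    congr 1
    rw [setIntegral_bold ha (Φ := fun z u => z * ∫ l : ℝ, expFun (t - u) l *
      (f l * g l / (f l + g l) : ℝ)) (by simp)]
    have h1 := integral_mul_integral_expFun ha1 ((integrable_mul_expFun hwi.ofReal t).congr
      (.of_forall fun l => mul_comm _ _))
    refine Eq.trans ?_ h1
    refine integral_congr_ae (.of_forall fun u => ?_)
    simp only
    congr 2; ext l
    rw [sub_eq_add_neg, add_comm, expFun_add, mul_assoc, hw]; rfl
  simp only [hQ]
  rw [setIntegral_bold ha (Φ := fun z t => (1 / (2 * Real.pi) : ℂ) *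
    (∫ l, G.symbolA a l * (expFun t l * w l)) * conj z) (by simp)]
  simp only [mul_assoc]
  rw [integral_const_mul]
  congr 1
  have hW : Integrable fun l => conj (G.symbolA a l * w l) := by
    have h1 : Integrable fun l => (w l : ℂ) * G.symbolA a l :=
      hwi.ofReal.mul_bdd hA.aestronglyMeasurable (.of_forall (G.norm_symbolA_le a))
    refine (LinearIsometryEquiv.integrable_comp_iff conjLIE).2 (h1.congr (.of_forall fun l => ?_))
    exact mul_comm _ _
  have h1 := congrArg conj (integral_mul_integral_expFun ha1 hW)
  rw [← integral_conj, ← integral_conj] at h1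
  refine Eq.trans ?_ (h1.trans ?_)
  · refine integral_congr_ae (.of_forall fun t => ?_)
    simp only
    rw [map_mul, ← integral_conj, mul_comm]
    congr 2; ext l
    rw [map_mul, conj_conj, conj_expFun, neg_neg]; ring
  · refine integral_congr_ae (.of_forall fun l => ?_)
    simp only
    rw [map_mul, conj_conj]; rfl

end Gaps

namespace Gaps

variable {G : Gaps} {f g : ℝ → ℝ}

/-! ### The observations -/

section observations

variable {Ω : Type*} [MeasurableSpace Ω] {P : Measure Ω} {ζ : ℝ → Ω → ℂ}

theorem mem_orthogonal_span_of_inner {E : Type*} [NormedAddCommGroup E] [InnerProductSpace ℂ E]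
    {s : Set E} {x : E} (h : ∀ y ∈ s, inner ℂ y x = 0) :
    ∀ y ∈ (Submodule.span ℂ s).topologicalClosure, inner ℂ y x = 0 := by
  have hV : (Submodule.span ℂ s).topologicalClosure ≤ (Submodule.span ℂ {x})ᗮ :=
    Submodule.topologicalClosure_minimal _
      (Submodule.span_le.2 fun y hy => Submodule.mem_orthogonal_singleton_iff_inner_left.2 (h y hy))
      (Submodule.isClosed_orthogonal _)
  exact fun y hy => Submodule.mem_orthogonal_singleton_iff_inner_left.1 (hV hy)

/-- The stochastic integral sends exponentials to observations, and the preimage of a closed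
subspace is closed. -/
theorem spectralMap_mem_obsSpace (hζ : IsStationary P ζ (f + g))
    {x : Lp ℂ 2 (specMeasure (f + g))} (hx : x ∈ G.specSpace f g) :
    spectralMap P ζ (f + g) x ∈ G.obsSpace P ζ := by
  have hle : G.specSpace f g ≤ (G.obsSpace P ζ).comap (spectralMap P ζ (f + g)).toLinearMap := by
    refine Submodule.topologicalClosure_minimal _ (Submodule.span_le.2 ?_)
      ((Submodule.isClosed_topologicalClosure _).preimage (spectralMap P ζ (f + g)).continuous)
    rintro _ ⟨t, ht, rfl⟩
    refine Submodule.le_topologicalClosure _ (Submodule.subset_span ⟨t, ht, ?_⟩)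
    exact (hζ.spectralMap_expFun t).symm
  exact hle hx

end observations

/-! ### The spectral characteristic -/

section characteristic

variable {a : ℝ → ℂ} {C : ℝ → ℂ}

/-- The spectral characteristic `(A f - C) / (f + g)`. -/
def characteristic (G : Gaps) (f g : ℝ → ℝ) (a C : ℝ → ℂ) (l : ℝ) : ℂ :=
  G.symbolA a l * (f l / (f l + g l)) - C l / (f l + g l)

theorem characteristic_mul {l : ℝ} (hl : 0 < f l + g l) :
    G.characteristic f g a C l * ((f + g) l : ℝ) = G.symbolA a l * f l - C l := by
  have : (f l + g l : ℂ) ≠ 0 := by exact_mod_cast hl.ne'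
  rw [characteristic, Pi.add_apply, ofReal_add]
  field_simp

theorem sub_characteristic {l : ℝ} (hl : 0 < f l + g l) :
    G.symbolA a l - G.characteristic f g a C l =
      (G.symbolA a l * g l + C l) / ((f l + g l : ℝ) : ℂ) := by
  have : (f l + g l : ℂ) ≠ 0 := by exact_mod_cast hl.ne'
  rw [characteristic, ofReal_add]
  field_simp
  ring

theorem characteristic_eq (l : ℝ) :
    G.characteristic f g a C l = (G.symbolA a l * f l - C l) / ((f l + g l : ℝ) : ℂ) := by
  rw [characteristic, ofReal_add]; ring

theorem ratio_mem (hf0 : ∀ l, 0 ≤ f l) (hg0 : ∀ l, 0 ≤ g l) (l : ℝ) :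
    0 ≤ f l / (f l + g l) ∧ f l / (f l + g l) ≤ 1 :=
  ⟨div_nonneg (hf0 l) (add_nonneg (hf0 l) (hg0 l)),
    div_le_one_of_le₀ (le_add_of_nonneg_right (hg0 l)) (add_nonneg (hf0 l) (hg0 l))⟩

theorem aestronglyMeasurable_ratio (hf : Integrable f) (hg : Integrable g) :
    AEStronglyMeasurable fun l => f l / (f l + g l) :=
  (hf.1.aemeasurable.div (hf.add hg).1.aemeasurable).aestronglyMeasurable

theorem aestronglyMeasurable_characteristic (hf : Integrable f) (hg : Integrable g)
    (ha : IntegrableOn a G.R) (hC : AEStronglyMeasurable C) :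
    AEStronglyMeasurable (G.characteristic f g a C) := by
  have h1 := (G.continuous_symbolA ha).aestronglyMeasurable (μ := volume)
  have h2 : AEStronglyMeasurable fun l => ((f l : ℂ) + g l) :=
    (hf.ofReal (𝕜 := ℂ)).1.add (hg.ofReal (𝕜 := ℂ)).1
  exact (h1.mul ((hf.ofReal (𝕜 := ℂ)).1.div₀ h2)).sub (hC.div₀ h2)

theorem memLp_characteristic (hf : Integrable f) (hg : Integrable g) (hf0 : ∀ l, 0 ≤ f l)
    (hg0 : ∀ l, 0 ≤ g l) (hp : ∀ᵐ l, 0 < f l + g l) (ha : IntegrableOn a G.R)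
    (hC : AEStronglyMeasurable C) (hC2 : MemLp C 2 (invMeasure f g)) :
    MemLp (G.characteristic f g a C) 2 (specMeasure (f + g)) := by
  have hm := aestronglyMeasurable_characteristic (G := G) hf hg ha hC
  rw [memLp_specMeasure_iff (hf.add hg) (fun l => add_nonneg (hf0 l) (hg0 l)) hm]
  set κ := ∫ t in G.R, ‖a t‖
  refine (((hf.add hg).const_mul (2 * κ ^ 2)).add
    (((memLp_invMeasure_iff hf hg hp hC).1 hC2).const_mul 2)).mono'
    ((hf.add hg).1.mul (hm.norm.pow 2)) ?_
  filter_upwards [hp] with l hl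
  have hr := ratio_mem hf0 hg0 l
  simp only [Pi.add_apply]
  rw [Real.norm_of_nonneg (mul_nonneg hl.le (by positivity))]
  have e1 : ‖G.symbolA a l * (f l / (f l + g l))‖ ≤ κ := by
    rw [norm_mul, ← ofReal_add, ← ofReal_div, norm_real, Real.norm_of_nonneg hr.1]
    exact (mul_le_of_le_one_right (norm_nonneg _) hr.2).trans (G.norm_symbolA_le a l)
  have e2 : ‖C l / (f l + g l)‖ = ‖C l‖ / (f l + g l) := by
    rw [norm_div, ← ofReal_add, norm_real, Real.norm_of_nonneg hl.le]
  have e3 : ‖G.characteristic f g a C l‖ ^ 2 ≤ 2 * κ ^ 2 + 2 * (‖C l‖ / (f l + g l)) ^ 2 := by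
    have h1 : ‖G.characteristic f g a C l‖ ≤ κ + ‖C l‖ / (f l + g l) :=
      (norm_sub_le _ _).trans (add_le_add e1 e2.le)
    calc ‖G.characteristic f g a C l‖ ^ 2 ≤ (κ + ‖C l‖ / (f l + g l)) ^ 2 := by gcongr
      _ ≤ _ := by nlinarith [sq_nonneg (κ - ‖C l‖ / (f l + g l))]
  calc (f l + g l) * ‖G.characteristic f g a C l‖ ^ 2
      ≤ (f l + g l) * (2 * κ ^ 2 + 2 * (‖C l‖ / (f l + g l)) ^ 2) := by gcongr
    _ = _ := by field_simp

theorem inner_opR (hf : Integrable f) (hg : Integrable g) (hf0 : ∀ l, 0 ≤ f l)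
    (hg0 : ∀ l, 0 ≤ g l) (ha : IntegrableOn a G.R) (ha2 : MemLp a 2 (volume.restrict G.R))
    (y : G.L2T) : inner ℂ y (G.opR f g (G.bold a ha2)) = (1 / (2 * Real.pi) : ℂ) *
      ∫ l, conj (G.fourierPlus y l) * (((f l / (f l + g l) : ℝ) : ℂ) * G.symbolA a l) := by
  have hm : MemLp (fun l => ((f l / (f l + g l) : ℝ) : ℂ) * G.fourierMinus (G.bold a ha2) l) 2 := by
    refine (G.memLp_fourierMinus (G.bold a ha2)).of_le
      ((aestronglyMeasurable_ratio hf hg).aemeasurable.complex_ofReal.aestronglyMeasurable.mul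
        (G.memLp_fourierMinus _).1) (.of_forall fun l => ?_)
    have hr := ratio_mem hf0 hg0 l
    rw [norm_mul, norm_real, Real.norm_of_nonneg hr.1]
    exact mul_le_of_le_one_left (norm_nonneg _) hr.2
  rw [opR, inner_synth _ _ hm]
  congr 1
  refine integral_congr_ae ?_
  filter_upwards [G.fourierMinus_bold ha ha2] with l hl
  rw [hl]

/-- The function `(A f - C) / (f + g)` lies in the closed span of the exponentials `e^{itλ}`,
`t ∈ ℝ⁻ \ S`. -/
theorem classL2_characteristic_mem (hf : Integrable f) (hg : Integrable g) (hf0 : ∀ l, 0 ≤ f l)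
    (hg0 : ∀ l, 0 ≤ g l) (hp : ∀ᵐ l, 0 < f l + g l) (ha : IntegrableOn a G.R)
    (ha2 : MemLp a 2 (volume.restrict G.R)) (hB : G.InvertibleB f g) :
    classL2 (specMeasure (f + g)) (G.characteristic f g a
      (G.fourierPlus (G.invB hB (G.opR f g (G.bold a ha2))))) ∈ G.specSpace f g := by
  set c := G.invB hB (G.opR f g (G.bold a ha2)) with hc
  have hcD : c ∈ G.formDomain f g := invB_mem_formDomain hB _
  have hh := memLp_characteristic (G := G) (a := a) hf hg hf0 hg0 hp ha
    (G.memLp_fourierPlus c).1 hcD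
  have hpi : Integrable (f + g) := hf.add hg
  have hp0 : ∀ l, 0 ≤ (f + g) l := fun l => add_nonneg (hf0 l) (hg0 l)
  -- The closed span is the double orthogonal complement, so it suffices to test against each `φ`
  -- orthogonal to the exponentials.
  rw [specSpace, ← Submodule.orthogonal_orthogonal_eq_closure, Submodule.mem_orthogonal]
  intro φ hφ
  set F : ℝ → ℂ := fun l => φ l * ((f + g) l : ℝ) with hF
  have hFi : Integrable F := integrable_mul_density hpi hp0 (Lp.memLp φ)
  have hφm : AEStronglyMeasurable (φ : ℝ → ℂ) := (Lp.stronglyMeasurable φ).aestronglyMeasurable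
  have hF0 : ∀ t ∈ G.obs, ∫ l, F l * expFun (-t) l = 0 := fun t ht => by
    have h1 := (Submodule.mem_orthogonal _ _).1 hφ _ (Submodule.subset_span ⟨t, ht, rfl⟩)
    have h2 := inner_expFun hpi hp0 (Lp.memLp φ) t
    rw [classL2_coe] at h2
    simp only at h1
    rw [h1, eq_comm, mul_eq_zero] at h2
    exact h2.resolve_left (by simp [Real.pi_ne_zero])
  have hFinv : MemLp F 2 (invMeasure f g) := by
    rw [memLp_invMeasure_iff hf hg hp hFi.1]
    refine (integrable_congr ?_).1 ((memLp_specMeasure_iff hpi hp0 hφm).1 (Lp.memLp φ))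
    filter_upwards [hp] with l hl
    simp only [hF, norm_mul, norm_real, Pi.add_apply, Real.norm_of_nonneg hl.le]
    field_simp
  -- This is what allows `F` to be the Plancherel transform of an element of `L₂(T)`, hence a
  -- legitimate test vector for the form.
  have hF2 := memLp_two_of_integral_expFun hB hf hg hp hFi hFinv hF0
  have hyF := G.fourierPlus_synth hFi hF2 hF0
  set y := G.synth F
  have hyD : y ∈ G.formDomain f g := (memLp_congr_ae ((ac f g).ae_le hyF)).2 hFinv
  have h1 := form_invB hB (G.opR f g (G.bold a ha2)) hyD
  rw [inner_opR hf hg hf0 hg0 ha ha2, ← hc, form] at h1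
  have h2 := mul_left_cancel₀ (by simp [Real.pi_ne_zero]) h1
  rw [integral_invMeasure hf hg hp] at h2
  have h3 := inner_classL2 (Lp.memLp φ) hh
  rw [classL2_coe] at h3
  rw [h3, integral_specMeasure hpi hp0]
  refine mul_eq_zero_of_right _ ?_
  have i1 : Integrable fun l => conj (G.fourierPlus y l) *
      (((f l / (f l + g l) : ℝ) : ℂ) * G.symbolA a l) := by
    have j : Integrable fun l => conj (F l) * (((f l / (f l + g l) : ℝ) : ℂ) * G.symbolA a l) := by
      refine ((LinearIsometryEquiv.integrable_comp_iff conjLIE).2 hFi).mul_bdd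
        (c := ∫ t in G.R, ‖a t‖) ((aestronglyMeasurable_ratio hf
          hg).aemeasurable.complex_ofReal.aestronglyMeasurable.mul
          (G.continuous_symbolA ha).aestronglyMeasurable) (.of_forall fun l => ?_)
      have hr := ratio_mem hf0 hg0 l
      rw [norm_mul, norm_real, Real.norm_of_nonneg hr.1]
      exact (mul_le_of_le_one_left (norm_nonneg _) hr.2).trans (G.norm_symbolA_le a l)
    refine j.congr ?_
    filter_upwards [hyF] with l hl
    rw [hl]
  have i2 : Integrable fun l => (f l + g l)⁻¹ • (conj (G.fourierPlus y l) * G.fourierPlus c l) := by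
    have j := G.form_integrable f g hcD hyD
    unfold invMeasure at j
    rw [integrable_withDensity_iff_integrable_smul₀' (aemeasurable_inv_ofReal hf hg)
      (ae_inv_ofReal_lt_top hp)] at j
    refine j.congr ?_
    filter_upwards [hp] with l hl
    rw [ENNReal.toReal_inv, ENNReal.toReal_ofReal hl.le]
  -- The form identity now reads `∫ F̄ (C - A f)/(f + g) = 0`; as `F = φ (f + g)`, this is minus the
  -- required inner product.
  rw [← sub_eq_zero, ← integral_sub i2 i1] at h2
  rw [← neg_eq_zero, ← integral_neg, ← h2]
  refine integral_congr_ae ?_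
  filter_upwards [hp, hyF] with l hl hy
  rw [mul_assoc, characteristic_mul hl, hy, hF]
  simp only [map_mul, conj_ofReal, Pi.add_apply, real_smul]
  have : ((f l : ℂ) + g l) ≠ 0 := by exact_mod_cast hl.ne'
  push_cast
  field_simp
  ring

end characteristic

end Gaps

end Filtering

end

/-! ### The optimal estimate and its error -/

open Filtering

theorem mainTheorem1 {Ω : Type*} [MeasurableSpace Ω] (P : Measure Ω) [IsProbabilityMeasure P]
    (ξ η : ℝ → Ω → ℂ) (f g : ℝ → ℝ)
    (hξ : Filtering.IsStationary P ξ f) (hη : Filtering.IsStationary P η g)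
    (hξη : Filtering.Uncorrelated P ξ η)
    (hmin : Filtering.Minimality f g)
    (G : Filtering.Gaps) (a : ℝ → ℂ)
    (ha1 : IntegrableOn a G.R) (ha2 : MemLp a 2 (volume.restrict G.R))
    (ha3 : IntegrableOn (fun t => t * ‖a t‖ ^ 2) G.R)
    (hB : G.InvertibleB f g) :
    let A : ℝ → ℂ := G.symbolA a
    let Ra : G.L2T := G.opR f g (G.bold a ha2)
    let c : G.L2T := G.invB hB Ra
    let C : ℝ → ℂ := G.fourierPlus c
    let h : ℝ → ℂ := fun l => A l * (f l / (f l + g l)) - C l / (f l + g l)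
    let Δ : ℝ := ∫ ω, ‖G.functional P ξ a ω - G.estimate P ξ η a ω‖ ^ 2 ∂P
    G.IsSpectralCharacteristic P ξ η f g h (G.estimate P ξ η a) ∧
    Integrable (fun l => ‖A l * g l + C l‖ ^ 2 / (f l + g l) ^ 2 * f l) ∧
    Integrable (fun l => ‖A l * f l - C l‖ ^ 2 / (f l + g l) ^ 2 * g l) ∧
    Δ = 1 / (2 * Real.pi) * (∫ l, ‖A l * g l + C l‖ ^ 2 / (f l + g l) ^ 2 * f l) +
      1 / (2 * Real.pi) * ∫ l, ‖A l * f l - C l‖ ^ 2 / (f l + g l) ^ 2 * g l ∧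
    (Δ : ℂ) = inner ℂ c Ra +
      ∫ t in G.T, G.opQ f g (G.bold a ha2) t * conj (G.bold a ha2 t) := by
  intro A Ra c C h Δ
  have hf := hξ.density_integrable
  have hg := hη.density_integrable
  have hf0 := hξ.density_nonneg
  have hg0 := hη.density_nonneg
  have hp := hmin.ae_pos hf hg
  have hS := hξ.add hη hξη
  have hcD : c ∈ G.formDomain f g := Gaps.invB_mem_formDomain hB _
  have hC : MemLp C 2 := G.memLp_fourierPlus c
  have hh : MemLp h 2 (specMeasure (f + g)) :=
    Gaps.memLp_characteristic hf hg hf0 hg0 hp ha1 hC.1 hcD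
  have hhm : AEStronglyMeasurable h := Gaps.aestronglyMeasurable_characteristic hf hg ha1 hC.1
  have hmem : classL2 (specMeasure (f + g)) h ∈ G.specSpace f g :=
    Gaps.classL2_characteristic_mem hf hg hf0 hg0 hp ha1 ha2 hB
  have hhf : MemLp h 2 (specMeasure f) := hh.mono_measure (specMeasure_le_add_right hg0)
  have hhg : MemLp h 2 (specMeasure g) := hh.mono_measure (specMeasure_le_add_left hf0)
  have hAc : Continuous A := G.continuous_symbolA ha1
  have hA : MemLp A 2 (specMeasure f) :=
    have := isFiniteMeasure_specMeasure hf
    memLp_of_bounded hAc.aestronglyMeasurable _ (G.norm_symbolA_le a)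
  have hAh : MemLp (A - h) 2 (specMeasure f) := hA.sub hhf
  have hAhm : AEStronglyMeasurable (A - h) := hAc.aestronglyMeasurable.sub hhm
  have hCi : Integrable C := integrable_of_memLp_invMeasure hf hg hp hC.1 hcD
  have hsplit := hξ.spectralIntegral_add hη hξη hh
  -- the error is orthogonal to the observations
  have hperp : ∀ w ∈ G.obsSpace P (ξ + η),
      inner ℂ w (G.functional P ξ a - spectralIntegral P (ξ + η) (f + g) h) = 0 := by
    refine Gaps.mem_orthogonal_span_of_inner ?_
    rintro _ ⟨t, ht, rfl⟩
    have h1 := hξ.spectralIntegral_add hη hξη (memLp_expFun hS.density_integrable t)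
    have e : classL2 P ((ξ + η) t) = spectralIntegral P (ξ + η) (f + g) (expFun t) :=
      (hS.spectralMap_expFun t).symm
    simp only
    rw [inner_sub_right, e, G.functional_eq hξ ha1]
    nth_rewrite 1 [h1]
    unfold spectralIntegral
    rw [inner_add_left, hξ.inner_spectralMap_of_uncorrelated hη hξη, hξ.inner_spectralMap,
      hS.inner_spectralMap, inner_expFun hf hf0 hA, inner_expFun hS.density_integrable
      hS.density_nonneg hh, add_zero, ← mul_sub]
    refine mul_eq_zero_of_right _ ?_
    rw [← integral_sub (integrable_mul_expFun (integrable_mul_density hf hf0 hA) _)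
      (integrable_mul_expFun (integrable_mul_density hS.density_integrable hS.density_nonneg hh) _)]
    -- The remaining integrand is `(A f - h (f + g)) e^{-itλ}`, that is, `C e^{-itλ}`.
    rw [← G.integral_fourierPlus_mul_expFun hCi t ht]
    refine integral_congr_ae ?_
    filter_upwards [hp] with l hl
    have h2 : h l * ((f + g) l : ℝ) = A l * f l - C l := Gaps.characteristic_mul hl
    rw [h2]; ring
  have hest : G.estimate P ξ η a = spectralIntegral P (ξ + η) (f + g) h := by
    refine (Submodule.eq_starProjection_of_mem_of_inner_eq_zero
      (Gaps.spectralMap_mem_obsSpace hS hmem) fun w hw => ?_)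
    rw [← inner_conj_symm, hperp w hw, map_zero]
  -- the error in terms of the spectral representations
  have herr : G.functional P ξ a - G.estimate P ξ η a =
      spectralMap P ξ f (classL2 (specMeasure f) (A - h)) -
        spectralMap P η g (classL2 (specMeasure g) h) := by
    rw [hest, hsplit, G.functional_eq hξ ha1, classL2_sub hA hhf, map_sub]
    unfold spectralIntegral
    exact (sub_sub _ _ _).symm
  have hΔ : Δ = ‖G.functional P ξ a - G.estimate P ξ η a‖ ^ 2 := by
    rw [norm_sq_eq_integral]
    refine integral_congr_ae ?_
    filter_upwards [Lp.coeFn_sub (G.functional P ξ a) (G.estimate P ξ η a)] with ω hω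
    rw [hω, Pi.sub_apply]
  have e1 : ∀ᵐ l, ‖(A - h) l‖ ^ 2 * f l = ‖A l * g l + C l‖ ^ 2 / (f l + g l) ^ 2 * f l := by
    filter_upwards [hp] with l hl
    have h1 : (A - h) l = (A l * g l + C l) / ((f l + g l : ℝ) : ℂ) := Gaps.sub_characteristic hl
    rw [h1, norm_div, div_pow, norm_real, Real.norm_of_nonneg hl.le]
  have e2 : ∀ᵐ l, ‖h l‖ ^ 2 * g l = ‖A l * f l - C l‖ ^ 2 / (f l + g l) ^ 2 * g l := by
    filter_upwards [hp] with l hl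
    have h1 : h l = (A l * f l - C l) / ((f l + g l : ℝ) : ℂ) := Gaps.characteristic_eq l
    rw [h1, norm_div, div_pow, norm_real, Real.norm_of_nonneg hl.le]
  refine ⟨⟨hh, hmem, hest.trans hsplit⟩, ?_, ?_, ?_, ?_⟩
  · refine (integrable_congr e1).1 ?_
    simpa only [mul_comm] using (memLp_specMeasure_iff hf hf0 hAhm).1 hAh
  · refine (integrable_congr e2).1 ?_
    simpa only [mul_comm] using (memLp_specMeasure_iff hg hg0 hhm).1 hhg
  · rw [hΔ, herr, @norm_sub_sq ℂ, ← inner_conj_symm,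
      hξ.inner_spectralMap_of_uncorrelated hη hξη, hξ.norm_spectralMap, hη.norm_spectralMap,
      norm_sq_classL2 hAh, norm_sq_classL2 hhg, integral_specMeasure_real hf hf0,
      integral_specMeasure_real hg hg0, integral_congr_ae e1, integral_congr_ae e2]
    simp
  -- The error is orthogonal to the estimate, so the second entry of `⟨error, error⟩` may be
  -- replaced by `Aξ`. The `η` part of the error then drops out by uncorrelatedness.
  · have h1 : (Δ : ℂ) = inner ℂ (G.functional P ξ a - G.estimate P ξ η a) (G.functional P ξ a) := by
      have h2 := hperp _ (Gaps.spectralMap_mem_obsSpace hS hmem)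
      have h3 : inner ℂ (G.functional P ξ a - G.estimate P ξ η a) (G.estimate P ξ η a) = 0 := by
        rw [hest, ← inner_conj_symm]
        exact (congrArg conj h2).trans (map_zero _)
      have h4 := inner_self_eq_norm_sq_to_K (𝕜 := ℂ) (G.functional P ξ a - G.estimate P ξ η a)
      rw [inner_sub_right, h3, sub_zero] at h4
      rw [h4, hΔ]; push_cast; rfl
    rw [h1, herr, inner_sub_left, G.functional_eq hξ ha1]
    unfold spectralIntegral
    rw [hξ.inner_spectralMap_of_uncorrelated hη hξη, sub_zero, hξ.inner_spectralMap,
      inner_classL2 hAh hA, integral_specMeasure hf hf0]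
    have hwi : Integrable fun l => f l * g l / (f l + g l) := by
      refine hg.mono' ((hf.1.mul hg.1).aemeasurable.div
        (hf.add hg).1.aemeasurable).aestronglyMeasurable (.of_forall fun l => ?_)
      have hr := Gaps.ratio_mem hf0 hg0 l
      rw [mul_div_right_comm, Real.norm_of_nonneg (mul_nonneg hr.1 (hg0 l))]
      exact mul_le_of_le_one_left (hg0 l) hr.2
    rw [Gaps.inner_opR hf hg hf0 hg0 ha1 ha2, Gaps.integral_opQ ha1 ha2 rfl hwi, ← mul_add]
    congr 1
    have i1 : Integrable fun l => conj (C l) * (((f l / (f l + g l) : ℝ) : ℂ) * A l) := by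
      refine ((LinearIsometryEquiv.integrable_comp_iff conjLIE).2 hCi).mul_bdd
        (c := ∫ t in G.R, ‖a t‖) ((Gaps.aestronglyMeasurable_ratio hf
          hg).aemeasurable.complex_ofReal.aestronglyMeasurable.mul
          hAc.aestronglyMeasurable) (.of_forall fun l => ?_)
      have hr := Gaps.ratio_mem hf0 hg0 l
      rw [norm_mul, norm_real, Real.norm_of_nonneg hr.1]
      exact (mul_le_of_le_one_left (norm_nonneg _) hr.2).trans (G.norm_symbolA_le a l)
    have i2 : Integrable fun l => conj (A l) * A l * ((f l * g l / (f l + g l) : ℝ) : ℂ) := by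
      refine hwi.ofReal.bdd_mul (c := (∫ t in G.R, ‖a t‖) * ∫ t in G.R, ‖a t‖)
        ((Complex.continuous_conj.comp hAc).mul hAc).aestronglyMeasurable (.of_forall fun l => ?_)
      rw [norm_mul, RCLike.norm_conj]
      exact mul_le_mul (G.norm_symbolA_le a l) (G.norm_symbolA_le a l) (norm_nonneg _)
        (integral_nonneg fun t => norm_nonneg _)
    -- Since `A - h = (A g + C)/(f + g)`, multiplying its conjugate by `A f` separates a `C` term,
    -- which is the `R` pairing, from `|A|² f g/(f + g)`, which is the `Q` form.
    refine Eq.trans ?_ (integral_add i1 i2)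
    refine integral_congr_ae ?_
    filter_upwards [hp] with l hl
    have h2 : (A - h) l = (A l * g l + C l) / ((f l + g l : ℝ) : ℂ) := Gaps.sub_characteristic hl
    rw [h2]
    simp only [map_div₀, map_add, map_mul, conj_ofReal]
    push_cast
    ring
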